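/- Let $M$ be a smooth connected manifold and let $\mathfrak g\to M$ be a smooth Lie algebroid: a real vector bundle of finite rank with a vector bundle morphism $\#\colon\mathfrak g\to TM$ (the anchor) and an $\mathbb R$-linear Lie bracket $[\cdot,\cdot]_{\mathfrak g}$ on $\Gamma(\mathfrak g)$ such that $\#[X,Y]_{\mathfrak g}=[\#X,\#Y]_{TM}$ and $[X,fY]_{\mathfrak g}=f[X,Y]_{\mathfrak g}+df(\#X)Y$. Let $\nabla$ be a Cartan connection on $\mathfrak g$, i.e. a smooth affine connection on the vector bundle $\mathfrak g$ such that, for all $X,Y\in\Gamma(\mathfrak g)$ and $V\in\Gamma(TM)$, $$\nabla_V[X,Y]_{\mathfrak g}=[\nabla_VX,Y]_{\mathfrak g}+[X,\nabla_VY]_{\mathfrak g}+\nabla_{\bar\nabla_YV}X-\nabla_{\bar\nabla_XV}Y,\qquad \bar\nabla_XV:=\#\nabla_VX+[\#X,V]_{TM}.$$ Suppose that $(\mathfrak g,\nabla)$ is transitive, i.e. that $\#\colon\mathfrak g\to TM$ is surjective. Let $\bar\nabla$ also denote the corresponding representation of $\mathfrak g$ on itself, $$\bar\nabla_XY:=\nabla_{\#Y}X+[X,Y]_{\mathfrak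 g},\qquad X,Y\in\Gamma(\mathfrak g),$$ and let $\operatorname{tor}\bar\nabla\,(X,Y):=\bar\nabla_XY-\bar\nabla_YX-[X,Y]_{\mathfrak g}$ be its torsion. Then $(\mathfrak g,\nabla)$ is locally symmetric if and only if $\operatorname{tor}\bar\nabla$ is $\bar\nabla$-parallel, i.e. for all $X,Y,Z\in\Gamma(\mathfrak g)$ $$\bar\nabla_Z\big(\operatorname{tor}\bar\nabla\,(X,Y)\big)-\operatorname{tor}\bar\nabla\,(\bar\nabla_ZX,Y)-\operatorname{tor}\bar\nabla\,(X,\bar\nabla_ZY)=0.$$ Here $(\mathfrak g,\nabla)$ is *locally symmetric* if every point of $M$ has an open neighbourhood $U$ such that the restriction $(\mathfrak g,\nabla)|_U$ is isomorphic, as a Lie algebroid with connection, to an action Lie algebroid $\mathfrak g_0\times U$ with its canonical flat connection. The action Lie algebroid is associated with a finite-dimensional real Lie algebra $\mathfrak g_0$ and a smooth Lie algebra homomorphism $\mathfrak g_0\to\Gamma(TU)$; its anchor is $(\xi,m)\mapsto\xi_m$, where $\xi_m\in T_mU$ is the value at $m$ of the vector field that is the image of $\xi$, and its bracket, on sections regarded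 as functions $\xi,\eta\colon U\to\mathfrak g_0$, is $[\xi,\eta]=d\eta(\#\xi)-d\xi(\#\eta)+[\xi(\cdot),\eta(\cdot)]_{\mathfrak g_0}$. -/

import Mathlib

open Bundle Filter
open scoped Manifold ContDiff Topology

noncomputable section

universe uE uH uM uF uV uG

section Algebroids

variable {E : Type uE} [NormedAddCommGroup E] [NormedSpace ℝ E]
  {H : Type uH} [TopologicalSpace H] {I : ModelWithCorners ℝ E H}
  {M : Type uM} [TopologicalSpace M] [ChartedSpace H M] [IsManifold I ∞ M]
  {F : Type uF} [NormedAddCommGroup F] [NormedSpace ℝ F]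
  {V : M → Type uV} [TopologicalSpace (TotalSpace F V)]
  [∀ x, AddCommGroup (V x)] [∀ x, Module ℝ (V x)] [∀ x, TopologicalSpace (V x)]
  [∀ x, IsTopologicalAddGroup (V x)] [∀ x, ContinuousSMul ℝ (V x)]
  [FiberBundle F V] [VectorBundle ℝ F V]

/-- The section `f X` for a smooth function `f` and a smooth section `X`. -/
def smulSection (f : M → ℝ) (hf : ContMDiff I 𝓘(ℝ, ℝ) ∞ f) (X : Cₛ^∞⟮I; F, V⟯) :
    Cₛ^∞⟮I; F, V⟯ :=
  ⟨fun x => f x • X x, hf.smul_section X.contMDiff⟩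

variable (I F V) in
/-- A smooth Lie algebroid structure on the vector bundle `V → M` (with model fibre `F`). -/
structure LieAlgebroid where
  /-- the anchor `# : V → TM`, a smooth vector bundle morphism over the identity -/
  anchor : ∀ x : M, V x →L[ℝ] TangentSpace I x
  anchor_smooth : ContMDiff (I.prod 𝓘(ℝ, F)) (I.prod 𝓘(ℝ, E)) ∞
    (fun p : TotalSpace F V => (⟨p.1, anchor p.1 p.2⟩ : TotalSpace E (TangentSpace I : M → Type _)))
  /-- the `ℝ`-bilinear bracket on the space of smooth sections -/
  bracket : Cₛ^∞⟮I; F, V⟯ →ₗ[ℝ] Cₛ^∞⟮I; F, V⟯ →ₗ[ℝ] Cₛ^∞⟮I; F, V⟯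
  bracket_self : ∀ X, bracket X X = 0
  jacobi : ∀ X Y Z, bracket X (bracket Y Z) = bracket (bracket X Y) Z + bracket Y (bracket X Z)
  /-- `[X, f Y] = f [X, Y] + df(#X) Y` -/
  bracket_smul : ∀ (X : Cₛ^∞⟮I; F, V⟯) (f : M → ℝ) (hf : ContMDiff I 𝓘(ℝ, ℝ) ∞ f)
    (Y : Cₛ^∞⟮I; F, V⟯) (x : M),
    bracket X (smulSection f hf Y) x
      = f x • bracket X Y x + mvfderiv I f x (anchor x (X x)) • Y x
  /-- `#[X, Y] = [#X, #Y]`, the right-hand side being the bracket of vector fields -/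
  anchor_bracket : ∀ (X Y : Cₛ^∞⟮I; F, V⟯) (x : M),
    anchor x (bracket X Y x) =
      VectorField.mlieBracket I (fun y => anchor y (X y)) (fun y => anchor y (Y y)) x

variable (I F V) in
/-- A smooth affine connection on `V → M`. In Mathlib's convention, `∇.toFun X x v` is `∇_v X`. -/
structure SmoothConnection extends CovariantDerivative I F V where
  smooth : ContMDiffCovariantDerivativeOn F ∞ toFun Set.univ

/-- The smooth section `∇_W X`, for a smooth vector field `W` and a smooth section `X`. -/
def SmoothConnection.along (D : SmoothConnection I F V)
    (W : Cₛ^∞⟮I; E, (TangentSpace I : M → Type _)⟯) (X : Cₛ^∞⟮I; F, V⟯) : Cₛ^∞⟮I; F, V⟯ :=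
  ⟨fun x => D.toFun X x (W x), by
    have h := D.smooth.contMDiff (σ := fun x => X x) (X.contMDiff.contMDiffOn)
    rw [contMDiffOn_univ] at h
    exact h.clm_bundle_apply W.contMDiff⟩

namespace LieAlgebroid

/-- The smooth vector field `#X`. -/
def anchorSection (A : LieAlgebroid I F V) (X : Cₛ^∞⟮I; F, V⟯) :
    Cₛ^∞⟮I; E, (TangentSpace I : M → Type _)⟯ :=
  ⟨fun x => A.anchor x (X x), A.anchor_smooth.comp X.contMDiff⟩

/-- A Lie algebroid is transitive if its anchor is surjective. -/
def IsTransitive (A : LieAlgebroid I F V) : Prop :=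
  ∀ x, Function.Surjective (A.anchor x)

/-- The value at `x` of `∇̄_X W = #∇_W X + [#X, W]`, for a vector field `W`. -/
def barTangent (A : LieAlgebroid I F V) (D : SmoothConnection I F V) (X : Cₛ^∞⟮I; F, V⟯)
    (W : Cₛ^∞⟮I; E, (TangentSpace I : M → Type _)⟯) (x : M) : TangentSpace I x :=
  A.anchor x (D.along W X x) + VectorField.mlieBracket I (A.anchorSection X) W x

/-- `∇` is a Cartan connection on the Lie algebroid:
`∇_W [X, Y] = [∇_W X, Y] + [X, ∇_W Y] + ∇_{∇̄_Y W} X - ∇_{∇̄_X W} Y`. -/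
def IsCartanConnection (A : LieAlgebroid I F V) (D : SmoothConnection I F V) : Prop :=
  ∀ (X Y : Cₛ^∞⟮I; F, V⟯) (W : Cₛ^∞⟮I; E, (TangentSpace I : M → Type _)⟯) (x : M),
    D.along W (A.bracket X Y) x =
      A.bracket (D.along W X) Y x + A.bracket X (D.along W Y) x
        + D.toFun X x (A.barTangent D Y W x) - D.toFun Y x (A.barTangent D X W x)

/-- The operator `∇̄_X Y = ∇_{#Y} X + [X, Y]` of the Lie algebroid on itself. -/
def bar (A : LieAlgebroid I F V) (D : SmoothConnection I F V) (X Y : Cₛ^∞⟮I; F, V⟯) :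
    Cₛ^∞⟮I; F, V⟯ :=
  D.along (A.anchorSection Y) X + A.bracket X Y

/-- The torsion `tor P (X, Y) = P_X Y - P_Y X - [X, Y]` of an operator `P` of the Lie algebroid on
itself. -/
def torsion (A : LieAlgebroid I F V)
    (P : Cₛ^∞⟮I; F, V⟯ → Cₛ^∞⟮I; F, V⟯ → Cₛ^∞⟮I; F, V⟯) (X Y : Cₛ^∞⟮I; F, V⟯) :
    Cₛ^∞⟮I; F, V⟯ :=
  P X Y - P Y X - A.bracket X Y

/-- The covariant derivative `(∇̄_Z T)(X, Y) = ∇̄_Z (T(X, Y)) - T(∇̄_Z X, Y) - T(X, ∇̄_Z Y)`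
vanishes for all smooth sections, where `T` is the torsion of `∇̄`. -/
def TorsionIsParallel (A : LieAlgebroid I F V) (D : SmoothConnection I F V) : Prop :=
  ∀ X Y Z : Cₛ^∞⟮I; F, V⟯,
    A.bar D Z (A.torsion (A.bar D) X Y) - A.torsion (A.bar D) (A.bar D Z X) Y
      - A.torsion (A.bar D) X (A.bar D Z Y) = 0

end LieAlgebroid

/-- A real Lie algebra structure on a normed space. (Mathlib's `LieRing` carries its own addition,
so it cannot be combined with `NormedAddCommGroup` on a variable type.) -/
structure LieStructure (G : Type uG) [NormedAddCommGroup G] [NormedSpace ℝ G] where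
  bracket : G →ₗ[ℝ] G →ₗ[ℝ] G
  bracket_self : ∀ ξ, bracket ξ ξ = 0
  jacobi : ∀ ξ η ζ, bracket ξ (bracket η ζ) = bracket (bracket ξ η) ζ + bracket η (bracket ξ ζ)

section Action

variable {G : Type uG} [NormedAddCommGroup G] [NormedSpace ℝ G]

variable (I) in
/-- A smooth infinitesimal action of the Lie algebra `(G, L)` on the open subset `U` of `M`: a Lie
algebra homomorphism from `G` to the vector fields on `U`. The vector field `toFun ξ` matters on `U`
only. -/
structure InfinitesimalAction (L : LieStructure G) (U : Set M) where
  toFun : G →ₗ[ℝ] (∀ x : M, TangentSpace I x)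
  smooth : ContMDiffOn (I.prod 𝓘(ℝ, G)) (I.prod 𝓘(ℝ, E)) ∞
    (fun p : M × G => (⟨p.1, toFun p.2 p.1⟩ : TotalSpace E (TangentSpace I : M → Type _)))
    (U ×ˢ Set.univ)
  map_bracket : ∀ (ξ η : G), ∀ x ∈ U,
    toFun (L.bracket ξ η) x = VectorField.mlieBracket I (toFun ξ) (toFun η) x

/-- The bracket of the action Lie algebroid `G × U`, on sections regarded as `G`-valued functions:
`[ξ, η] = dη(#ξ) - dξ(#η) + τ(ξ, η)`, with `τ` the pointwise Lie bracket. -/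
def InfinitesimalAction.bracket {L : LieStructure G} {U : Set M} (a : InfinitesimalAction I L U)
    (ξ η : M → G) (x : M) : G :=
  mvfderiv I η x (a.toFun (ξ x) x) - mvfderiv I ξ x (a.toFun (η x) x) + L.bracket (ξ x) (η x)

/-- An isomorphism of Cartan algebroids over the open set `U`, from the action Lie algebroid `G × U`
with its canonical flat connection to the restriction to `U` of the Lie algebroid `A` with the
connection `D`. Sections over `U` are represented by functions on `M` that are smooth on `U`. -/
structure ActionIso (A : LieAlgebroid I F V) (D : SmoothConnection I F V) (U : Set M)
    {L : LieStructure G} (a : InfinitesimalAction I L U) where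
  /-- the map on fibres; it matters on `U` only -/
  map : ∀ x : M, G →L[ℝ] V x
  bijective : ∀ x ∈ U, Function.Bijective (map x)
  smooth : ContMDiffOn (I.prod 𝓘(ℝ, G)) (I.prod 𝓘(ℝ, F)) ∞
    (fun p : M × G => (⟨p.1, map p.1 p.2⟩ : TotalSpace F V)) (U ×ˢ Set.univ)
  anchor_map : ∀ x ∈ U, ∀ ξ : G, A.anchor x (map x ξ) = a.toFun ξ x
  /-- The map preserves brackets of sections over `U`. The bracket of the restriction of `A` to `U`
  is the local operator induced by that of `A`: at `x` it is computed by means of any global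
  sections `X`, `Y` that agree near `x` with the given sections over `U`. -/
  map_bracket : ∀ ξ η : M → G, ContMDiffOn I 𝓘(ℝ, G) ∞ ξ U → ContMDiffOn I 𝓘(ℝ, G) ∞ η U →
    ∀ x ∈ U, ∀ X Y : Cₛ^∞⟮I; F, V⟯,
      (∀ᶠ y in 𝓝 x, X y = map y (ξ y)) → (∀ᶠ y in 𝓝 x, Y y = map y (η y)) →
        A.bracket X Y x = map x (a.bracket ξ η x)
  /-- The map carries the canonical flat connection `d` to `∇`. -/
  map_connection : ∀ ξ : M → G, ContMDiffOn I 𝓘(ℝ, G) ∞ ξ U →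
    ∀ x ∈ U, ∀ v : TangentSpace I x,
      D.toFun (fun y => map y (ξ y)) x v = map x (mvfderiv I ξ x v)

end Action

namespace LieAlgebroid

/-- The restriction to the open set `U` is symmetric: it is isomorphic to an action algebroid with
its canonical flat connection. The Lie algebra, having the dimension of `F`, may be taken in the
universe of `F`. -/
def IsSymmetricOn (A : LieAlgebroid I F V) (D : SmoothConnection I F V) (U : Set M) : Prop :=
  ∃ (G : Type uF) (_ : NormedAddCommGroup G) (_ : NormedSpace ℝ G) (_ : FiniteDimensional ℝ G)
    (L : LieStructure G) (a : InfinitesimalAction I L U), Nonempty (ActionIso A D U a)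

/-- Every point has an open neighbourhood on which the algebroid is symmetric. -/
def IsLocallySymmetric (A : LieAlgebroid I F V) (D : SmoothConnection I F V) : Prop :=
  ∀ x : M, ∃ U : Set M, IsOpen U ∧ x ∈ U ∧ A.IsSymmetricOn D U

end LieAlgebroid

end Algebroids

end

/-! Everything passes through the curvature `R` of `∇`. Inserting the Cartan identity for `∇_{#Y}[Z,
X]` and `∇_{#X}[Z, Y]`, together with the Jacobi identity, into the covariant derivative of the
torsion gives `(∇̄_Z tor ∇̄)(X, Y) = R(#X, #Y) Z` (`IsCartanConnection.bar_torsion_eq_curvature`).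
Parallel torsion thus means that `∇` is flat along the image of the anchor.

In an action algebroid the constant sections are parallel and pass through every vector. Since
`R(#X, #Y) Z` is tensorial in `Z`, local symmetry forces it to vanish
(`IsLocallySymmetric.curvature_eq_zero`).

Conversely, transitivity turns `R(#X, #Y) = 0` into `R = 0`, so parallel frames exist locally
(`SmoothConnection.exists_parallel_frame`). In a chart this asks for an invertible solution of `dg =
-Ω g`. It is found by solving the equation along rays; flatness makes the radial solution satisfy
the equation in all directions (`radial_transport_estimate`, `exists_flat_gauge`).

The Cartan identity makes the bracket of two parallel sections parallel, hence a combination of the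
frame with constant coefficients. The parallel sections therefore form a Lie algebra, which acts
through the anchor (`IsCartanConnection.exists_lieStructure`). Brackets of arbitrary sections are
then determined because `tor ∇̄` is tensorial, so the frame identifies the algebroid with the action
algebroid (`isSymmetricOn_of_parallel_frame`). -/

set_option linter.unusedSectionVars false

/-! ### Global smooth sections, tensoriality, and the Leibniz rule in a frame -/

section Sections

variable {E : Type*} [NormedAddCommGroup E] [NormedSpace ℝ E] [FiniteDimensional ℝ E]
  {M : Type*} [TopologicalSpace M] [T2Space M] [ChartedSpace E M] [IsManifold 𝓘(ℝ, E) ∞ M]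
  {F : Type*} [NormedAddCommGroup F] [NormedSpace ℝ F]
  {V : M → Type*} [TopologicalSpace (TotalSpace F V)]
  [∀ x, AddCommGroup (V x)] [∀ x, Module ℝ (V x)] [∀ x, TopologicalSpace (V x)]
  [∀ x, IsTopologicalAddGroup (V x)] [∀ x, ContinuousSMul ℝ (V x)]
  [FiberBundle F V] [VectorBundle ℝ F V]

/-- A smooth function that is `1` near `x` and supported in a given neighbourhood of `x`. -/
theorem exists_smooth_cutoff {x : M} {s : Set M} (hs : s ∈ 𝓝 x) :
    ∃ ψ : M → ℝ, ContMDiff 𝓘(ℝ, E) 𝓘(ℝ, ℝ) ∞ ψ ∧ (∀ᶠ y in 𝓝 x, ψ y = 1) ∧ tsupport ψ ⊆ s := by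
  obtain ⟨f, -, hf⟩ := (SmoothBumpFunction.nhds_basis_tsupport (I := 𝓘(ℝ, E)) x).mem_iff.1 hs
  exact ⟨f, f.contMDiff, f.eventuallyEq_one, hf⟩

@[simp]
theorem smulSection_apply (f : M → ℝ) (hf : ContMDiff 𝓘(ℝ, E) 𝓘(ℝ, ℝ) ∞ f)
    (X : Cₛ^∞⟮𝓘(ℝ, E); F, V⟯) (x : M) : smulSection f hf X x = f x • X x := rfl

/-- A smooth local section agrees near a given point with a smooth global section. -/
theorem exists_section_eventuallyEq {U : Set M} (hU : IsOpen U) {x : M} (hx : x ∈ U)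
    {σ : ∀ y, V y}
    (hσ : ContMDiffOn 𝓘(ℝ, E) (𝓘(ℝ, E).prod 𝓘(ℝ, F)) ∞ (fun y => TotalSpace.mk' F y (σ y)) U) :
    ∃ X : Cₛ^∞⟮𝓘(ℝ, E); F, V⟯, ∀ᶠ y in 𝓝 x, X y = σ y := by
  obtain ⟨ψ, hψ, h1, hs⟩ := exists_smooth_cutoff (E := E) (hU.mem_nhds hx)
  refine ⟨⟨ψ • σ, hψ.contMDiffOn.smul_section_of_tsupport hU hs hσ⟩, h1.mono fun y hy => ?_⟩
  change ψ y • σ y = σ y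
  rw [hy, one_smul]

/-- A smooth bundle has, near any point, a frame of smooth global sections which is constant in the
preferred trivialization. -/
theorem exists_sections_eventuallyEq_symm [ContMDiffVectorBundle ∞ F V 𝓘(ℝ, E)] (x₀ : M) :
    ∃ S : F →ₗ[ℝ] Cₛ^∞⟮𝓘(ℝ, E); F, V⟯, ∀ᶠ x in 𝓝 x₀,
      ∀ f, S f x = (trivializationAt F V x₀).symmL ℝ x f := by
  set e := trivializationAt F V x₀
  have hx₀ : x₀ ∈ e.baseSet := FiberBundle.mem_baseSet_trivializationAt F V x₀
  obtain ⟨ψ, hψ, h1, hs⟩ := exists_smooth_cutoff (E := E) (e.open_baseSet.mem_nhds hx₀)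
  have sm : ∀ f : F, ContMDiffOn 𝓘(ℝ, E) (𝓘(ℝ, E).prod 𝓘(ℝ, F)) ∞
      (fun y => TotalSpace.mk' F y (e.symmL ℝ y f)) e.baseSet := fun f => by
    rw [e.contMDiffOn_section_baseSet_iff]
    refine (contMDiffOn_const (c := f)).congr fun y hy => ?_
    rw [e.symmL_apply hy, e.apply_mk_symm hy]
  refine ⟨{ toFun := fun f => ⟨ψ • fun y => e.symmL ℝ y f,
              hψ.contMDiffOn.smul_section_of_tsupport e.open_baseSet hs (sm f)⟩
            map_add' := fun f g => ?_
            map_smul' := fun c f => ?_ }, h1.mono fun y hy f => ?_⟩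
  · ext y
    change ψ y • e.symmL ℝ y (f + g) = ψ y • e.symmL ℝ y f + ψ y • e.symmL ℝ y g
    rw [← smul_add, map_add]
  · ext y
    change ψ y • e.symmL ℝ y (c • f) = c • ψ y • e.symmL ℝ y f
    rw [smul_comm c, map_smul]
  · change ψ y • e.symmL ℝ y f = e.symmL ℝ y f
    rw [hy, one_smul]

variable (F V) in
/-- Evaluation of smooth sections at a point. -/
noncomputable def sectionEval (x : M) : Cₛ^∞⟮𝓘(ℝ, E); F, V⟯ →ₗ[ℝ] V x where
  toFun X := X x
  map_add' _ _ := rfl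
  map_smul' _ _ := rfl

theorem sum_section_apply {ι : Type*} (s : Finset ι) (X : ι → Cₛ^∞⟮𝓘(ℝ, E); F, V⟯) (x : M) :
    (∑ i ∈ s, X i) x = ∑ i ∈ s, X i x :=
  map_sum (sectionEval F V x) X s

theorem linear_sections_apply_eq_sum {G : Type*} [AddCommGroup G] [Module ℝ G] {ι : Type*}
    [Fintype ι] (b : Module.Basis ι ℝ G) (S : G →ₗ[ℝ] Cₛ^∞⟮𝓘(ℝ, E); F, V⟯) (g : G) (x : M) :
    S g x = ∑ i, b.coord i g • S (b i) x := by
  conv_lhs => rw [← b.sum_repr g]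
  change ((sectionEval F V x).comp S) _ = _
  rw [map_sum]
  exact Finset.sum_congr rfl fun i _ => map_smul _ _ _

/-- A linear family of smooth sections is smooth jointly in the parameter and the point. -/
theorem contMDiff_linear_sections {G : Type*} [NormedAddCommGroup G] [NormedSpace ℝ G]
    [FiniteDimensional ℝ G] (S : G →ₗ[ℝ] Cₛ^∞⟮𝓘(ℝ, E); F, V⟯) :
    ContMDiff (𝓘(ℝ, E).prod 𝓘(ℝ, G)) (𝓘(ℝ, E).prod 𝓘(ℝ, F)) ∞
      (fun p : M × G => (⟨p.1, S p.2 p.1⟩ : TotalSpace F V)) := by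
  intro p
  set b := Module.finBasis ℝ G
  set e := trivializationAt F V p.1
  have hp : p.1 ∈ e.baseSet := FiberBundle.mem_baseSet_trivializationAt F V p.1
  rw [contMDiffAt_totalSpace]
  refine ⟨contMDiffAt_fst, ?_⟩
  have h1 : ∀ i, ContMDiffAt (𝓘(ℝ, E).prod 𝓘(ℝ, G)) 𝓘(ℝ, F) ∞
      (fun q : M × G => (e ⟨q.1, S (b i) q.1⟩).2) p := fun i =>
    ((contMDiffAt_section p.1).1 ((S (b i)).contMDiff p.1)).comp p contMDiffAt_fst
  have h2 : ∀ i, ContMDiffAt (𝓘(ℝ, E).prod 𝓘(ℝ, G)) 𝓘(ℝ, ℝ) ∞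
      (fun q : M × G => b.coord i q.2) p := fun i =>
    ((LinearMap.toContinuousLinearMap (b.coord i)).contMDiff.contMDiffAt).comp p contMDiffAt_snd
  refine (ContMDiffAt.sum (t := Finset.univ) fun i _ => (h2 i).smul (h1 i)).congr_of_eventuallyEq ?_
  filter_upwards [continuous_fst.continuousAt.preimage_mem_nhds (e.open_baseSet.mem_nhds hp)]
    with q hq
  change (e ⟨q.1, S q.2 q.1⟩).2 = ∑ i, b.coord i q.2 • (e ⟨q.1, S (b i) q.1⟩).2
  have h3 : ∀ v : V q.1, (e ⟨q.1, v⟩).2 = e.linearEquivAt ℝ q.1 hq v := fun v => rfl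
  simp only [h3]
  rw [linear_sections_apply_eq_sum b, map_sum]
  exact Finset.sum_congr rfl fun i _ => map_smul _ _ _

/-- An additive map on smooth sections that is linear over smooth functions, evaluated at `x`,
depends only on the value at `x`. -/
theorem map_eq_of_apply_eq [FiniteDimensional ℝ F] [ContMDiffVectorBundle ∞ F V 𝓘(ℝ, E)]
    {A : Type*} [AddCommGroup A] [Module ℝ A]
    (Φ : Cₛ^∞⟮𝓘(ℝ, E); F, V⟯ →+ A) {x : M}
    (hΦ : ∀ (f : M → ℝ) (hf : ContMDiff 𝓘(ℝ, E) 𝓘(ℝ, ℝ) ∞ f) (X : Cₛ^∞⟮𝓘(ℝ, E); F, V⟯),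
      Φ (smulSection f hf X) = f x • Φ X)
    {X Y : Cₛ^∞⟮𝓘(ℝ, E); F, V⟯} (h : X x = Y x) : Φ X = Φ Y := by
  suffices H : ∀ Z : Cₛ^∞⟮𝓘(ℝ, E); F, V⟯, Z x = 0 → Φ Z = 0 by
    rw [← sub_eq_zero, ← map_sub]
    exact H _ (by simp [h])
  intro Z hZ
  set e := trivializationAt F V x
  have : ContMDiffVectorBundle 1 F V 𝓘(ℝ, E) := .of_le (n := ∞) (by exact_mod_cast le_top)
  have hx : x ∈ e.baseSet := FiberBundle.mem_baseSet_trivializationAt F V x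
  set b := Module.finBasis ℝ F
  obtain ⟨ψ, hψ, h1, hs⟩ := exists_smooth_cutoff (E := E) (e.open_baseSet.mem_nhds hx)
  let s : ∀ i, Cₛ^∞⟮𝓘(ℝ, E); F, V⟯ := fun i => ⟨ψ • e.localFrame b i,
    hψ.contMDiffOn.smul_section_of_tsupport e.open_baseSet hs
      (e.contMDiffOn_localFrame_baseSet ∞ b i)⟩
  let c : ∀ i, M → ℝ := fun i y => ψ y * e.localFrameCoeff 𝓘(ℝ, E) b i y (Z y)
  have hc : ∀ i, ContMDiff 𝓘(ℝ, E) 𝓘(ℝ, ℝ) ∞ (c i) := fun i =>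
    contMDiff_of_tsupport fun y hy => hψ.contMDiffAt.mul
      (contMDiffAt_localFrameCoeff b (hs (tsupport_mul_subset_left hy)) Z.contMDiff.contMDiffAt i)
  -- One factor `ψ` globalizes the coefficients of `Z`, the other the local frame. At `x` the left
  -- side is `Z`, since `ψ x = 1`, and every coefficient on the right vanishes with `Z x`.
  have hsum : smulSection (fun y => ψ y * ψ y) (hψ.mul hψ) Z
      = ∑ i, smulSection (c i) (hc i) (s i) := by
    ext y
    have hco : (∑ i, smulSection (c i) (hc i) (s i)) y = ∑ i, c i y • ψ y • e.localFrame b i y :=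
      sum_section_apply _ _ y
    rw [hco]
    change (ψ y * ψ y) • Z y = _
    by_cases hy : y ∈ e.baseSet
    · conv_lhs => rw [Trivialization.eq_sum_localFrameCoeff_smul (I := 𝓘(ℝ, E)) (e := e) (b := b)
        (s := fun y => Z y) hy]
      rw [Finset.smul_sum]
      refine Finset.sum_congr rfl fun i _ => ?_
      simp only [c, smul_smul]
      congr 1
      ring
    · have : ψ y = 0 := image_eq_zero_of_notMem_tsupport fun h => hy (hs h)
      simp [this]
  have hone : ψ x = 1 := h1.self_of_nhds
  have := hΦ (fun y => ψ y * ψ y) (hψ.mul hψ) Z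
  rw [hsum, map_sum, hone, mul_one, one_smul] at this
  rw [← this]
  refine Finset.sum_eq_zero fun i _ => ?_
  rw [hΦ]
  simp [c, hZ]

variable (D : SmoothConnection 𝓘(ℝ, E) F V)

namespace SmoothConnection

theorem along_apply (W : Cₛ^∞⟮𝓘(ℝ, E); E, (TangentSpace 𝓘(ℝ, E) : M → Type _)⟯)
    (X : Cₛ^∞⟮𝓘(ℝ, E); F, V⟯) (x : M) : D.along W X x = D.toFun X x (W x) := rfl

theorem toFun_add (X Y : Cₛ^∞⟮𝓘(ℝ, E); F, V⟯) (x : M) :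
    D.toFun (X + Y : Cₛ^∞⟮𝓘(ℝ, E); F, V⟯) x = D.toFun X x + D.toFun Y x :=
  D.isCovariantDerivativeOnUniv.add X.mdifferentiableAt Y.mdifferentiableAt

theorem toFun_smulSection {f : M → ℝ} (hf : ContMDiff 𝓘(ℝ, E) 𝓘(ℝ, ℝ) ∞ f)
    (X : Cₛ^∞⟮𝓘(ℝ, E); F, V⟯) (x : M) (w : TangentSpace 𝓘(ℝ, E) x) :
    D.toFun (smulSection f hf X) x w
      = f x • D.toFun X x w + mvfderiv 𝓘(ℝ, E) f x w • X x := by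
  have := D.isCovariantDerivativeOnUniv.leibniz (σ := fun y => X y) (g := f) (x := x)
    X.mdifferentiableAt ((hf x).mdifferentiableAt (by simp))
  exact congrArg (fun T => T w) this

theorem along_add (W : Cₛ^∞⟮𝓘(ℝ, E); E, (TangentSpace 𝓘(ℝ, E) : M → Type _)⟯)
    (X Y : Cₛ^∞⟮𝓘(ℝ, E); F, V⟯) : D.along W (X + Y) = D.along W X + D.along W Y := by
  ext x
  exact congrArg (fun T => T (W x)) (D.toFun_add X Y x)

theorem add_along (W W' : Cₛ^∞⟮𝓘(ℝ, E); E, (TangentSpace 𝓘(ℝ, E) : M → Type _)⟯)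
    (X : Cₛ^∞⟮𝓘(ℝ, E); F, V⟯) : D.along (W + W') X = D.along W X + D.along W' X := by
  ext x
  exact map_add (D.toFun X x) (W x) (W' x)

theorem sub_along (W W' : Cₛ^∞⟮𝓘(ℝ, E); E, (TangentSpace 𝓘(ℝ, E) : M → Type _)⟯)
    (X : Cₛ^∞⟮𝓘(ℝ, E); F, V⟯) : D.along (W - W') X = D.along W X - D.along W' X := by
  ext x
  exact map_sub (D.toFun X x) (W x) (W' x)

theorem along_smulSection (W : Cₛ^∞⟮𝓘(ℝ, E); E, (TangentSpace 𝓘(ℝ, E) : M → Type _)⟯)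
    {f : M → ℝ} (hf : ContMDiff 𝓘(ℝ, E) 𝓘(ℝ, ℝ) ∞ f) (X : Cₛ^∞⟮𝓘(ℝ, E); F, V⟯) (x : M) :
    D.along W (smulSection f hf X) x
      = f x • D.along W X x + mvfderiv 𝓘(ℝ, E) f x (W x) • X x :=
  D.toFun_smulSection hf X x (W x)

theorem smulSection_along (W : Cₛ^∞⟮𝓘(ℝ, E); E, (TangentSpace 𝓘(ℝ, E) : M → Type _)⟯)
    {f : M → ℝ} (hf : ContMDiff 𝓘(ℝ, E) 𝓘(ℝ, ℝ) ∞ f) (X : Cₛ^∞⟮𝓘(ℝ, E); F, V⟯) :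
    D.along (smulSection f hf W) X = smulSection f hf (D.along W X) := by
  ext x
  exact map_smul (D.toFun X x) (f x) (W x)

theorem toFun_congr {σ τ : ∀ y, V y} {x : M}
    (hτ : MDifferentiableAt 𝓘(ℝ, E) (𝓘(ℝ, E).prod 𝓘(ℝ, F)) (fun y => TotalSpace.mk' F y (τ y)) x)
    (h : ∀ᶠ y in 𝓝 x, σ y = τ y) : D.toFun σ x = D.toFun τ x :=
  D.isCovariantDerivativeOnUniv.congr_of_eventuallyEq
    (hτ.congr_of_eventuallyEq (h.mono fun y hy => by simp [hy])) hτ univ_mem h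

theorem toFun_eq_zero {σ : ∀ y, V y} {x : M} (h : ∀ᶠ y in 𝓝 x, σ y = 0) : D.toFun σ x = 0 := by
  rw [D.toFun_congr (τ := fun y => (0 : Cₛ^∞⟮𝓘(ℝ, E); F, V⟯) y)
    (ContMDiffSection.mdifferentiableAt _) (by simpa using h)]
  exact D.isCovariantDerivativeOnUniv.zero

/-- The Leibniz rule for combinations of sections depending linearly on a parameter. -/
theorem toFun_linear_sections {G : Type*} [NormedAddCommGroup G] [NormedSpace ℝ G]
    [FiniteDimensional ℝ G] (S : G →ₗ[ℝ] Cₛ^∞⟮𝓘(ℝ, E); F, V⟯) {u : M → G} {x : M}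
    (hu : MDifferentiableAt 𝓘(ℝ, E) 𝓘(ℝ, G) u x) (w : TangentSpace 𝓘(ℝ, E) x) :
    D.toFun (fun y => S (u y) y) x w
      = S (mvfderiv 𝓘(ℝ, E) u x w) x + D.toFun (S (u x)) x w := by
  set b := Module.finBasis ℝ G
  have key : ∀ v : M → G, MDifferentiableAt 𝓘(ℝ, E) 𝓘(ℝ, G) v x →
      D.toFun (fun y => S (v y) y) x w = ∑ i, (b.coord i (v x) • D.toFun (S (b i)) x w
        + b.coord i (mvfderiv 𝓘(ℝ, E) v x w) • S (b i) x) := by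
    intro v hv
    have hc : ∀ i, MDifferentiableAt 𝓘(ℝ, E) 𝓘(ℝ, ℝ) (fun y => b.coord i (v y)) x ∧
        mvfderiv 𝓘(ℝ, E) (fun y => b.coord i (v y)) x w
          = b.coord i (mvfderiv 𝓘(ℝ, E) v x w) := by
      intro i
      set T := LinearMap.toContinuousLinearMap (b.coord i)
      have hT : MDifferentiableAt 𝓘(ℝ, G) 𝓘(ℝ, ℝ) T (v x) :=
        T.differentiableAt.mdifferentiableAt
      refine ⟨hT.comp x hv, ?_⟩
      have := mvfderiv_comp_apply x hT hv w
      refine this.trans ?_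
      rw [mvfderiv, mfderiv_eq_fderiv, T.fderiv]
      rfl
    have hsec : ∀ i, MDifferentiableAt 𝓘(ℝ, E) (𝓘(ℝ, E).prod 𝓘(ℝ, F))
        (fun y => TotalSpace.mk' F y (b.coord i (v y) • S (b i) y)) x := fun i =>
      (hc i).1.smul_section (S (b i)).mdifferentiableAt
    have hsum : ∀ s : Finset _, D.toFun (fun y => ∑ i ∈ s, b.coord i (v y) • S (b i) y) x w
        = ∑ i ∈ s, (b.coord i (v x) • D.toFun (S (b i)) x w
          + b.coord i (mvfderiv 𝓘(ℝ, E) v x w) • S (b i) x) := by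
      intro s
      induction s using Finset.induction_on with
      | empty =>
        simp only [Finset.sum_empty]
        rw [D.toFun_eq_zero (Eventually.of_forall fun _ => rfl)]
        rfl
      | insert i s hi ih =>
        simp only [Finset.sum_insert hi]
        rw [← ih, ← (hc i).2]
        have e1 := D.isCovariantDerivativeOnUniv.add (hsec i)
          (MDifferentiableAt.sum_section (s := s) fun j _ => hsec j)
        have e2 := D.isCovariantDerivativeOnUniv.leibniz (σ := fun y => S (b i) y)
          (S (b i)).mdifferentiableAt (hc i).1
        refine (congrArg (fun T => T w) e1).trans ?_
        exact congrArg₂ (· + ·) (congrArg (fun T => T w) e2) rfl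
    rw [← hsum]
    congr 2
    ext y
    exact linear_sections_apply_eq_sum b S (v y) y
  -- For the constant parameter `u x` the expansion identifies the undifferentiated half of the sum
  -- with the derivative of `S (u x)`.
  have h0 := key (fun _ => u x) mdifferentiableAt_const
  rw [key u hu, Finset.sum_add_distrib, linear_sections_apply_eq_sum b S _ x, add_comm]
  congr 1
  refine Eq.trans ?_ h0.symm
  simp [mvfderiv_const]

end SmoothConnection

end Sections

/-! ### Integration of a flat connection form on a ball -/

section FlatTransport

open Set Metric

variable {E : Type*} [NormedAddCommGroup E] [NormedSpace ℝ E]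
  {R : Type*} [NormedRing R] [NormedAlgebra ℝ R]

/-- A linear ordinary differential equation with small coefficients is solvable on `[0, 1]`. -/
theorem exists_linear_ode_solution [CompleteSpace R] {a : ℝ → R}
    (ha : ContinuousOn a (Icc 0 1)) {κ : ℝ} (hκ : ∀ t ∈ Icc (0 : ℝ) 1, ‖a t‖ ≤ κ)
    (hκ1 : κ * (‖(1 : R)‖ + 1) ≤ 1) :
    ∃ u : ℝ → R, u 0 = 1 ∧
      ∀ t ∈ Icc (0 : ℝ) 1, HasDerivWithinAt u (-(a t * u t)) (Icc 0 1) t := by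
  have hκ0 : 0 ≤ κ := (norm_nonneg _).trans (hκ 0 (by simp))
  -- On the unit ball about `1` one has `‖y‖ ≤ ‖1‖ + 1`, so the field is bounded by `κ (‖1‖ + 1) ≤
  -- 1` and a solution cannot leave the ball within time `1`.
  have h : IsPicardLindelof (fun t y => -(a t * y)) (⟨0, by simp⟩ : Icc (0 : ℝ) 1) (1 : R) 1 0 1
      ⟨κ, hκ0⟩ := by
    refine ⟨fun t ht => ?_, fun y _ => ?_, fun t ht y hy => ?_, by simp⟩
    · refine LipschitzOnWith.of_dist_le_mul fun y _ z _ => ?_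
      rw [dist_eq_norm, dist_eq_norm, show -(a t * y) - -(a t * z) = -(a t * (y - z)) by
        noncomm_ring, norm_neg]
      exact (norm_mul_le _ _).trans (mul_le_mul_of_nonneg_right (hκ t ht) (norm_nonneg _))
    · exact (ha.mul continuousOn_const).neg
    · have hy' : ‖y‖ ≤ ‖(1 : R)‖ + 1 := by
        have := norm_le_norm_add_norm_sub' y 1
        have h2 : ‖y - 1‖ ≤ 1 := by simpa [dist_eq_norm] using hy
        linarith
      rw [norm_neg]
      calc ‖a t * y‖ ≤ ‖a t‖ * ‖y‖ := norm_mul_le _ _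
        _ ≤ κ * (‖(1 : R)‖ + 1) := mul_le_mul (hκ t ht) hy' (norm_nonneg _) hκ0
        _ ≤ 1 := hκ1
  obtain ⟨u, hu0, hu⟩ := h.exists_eq_forall_mem_Icc_hasDerivWithinAt₀
  exact ⟨u, hu0, hu⟩

/-- Grönwall's bound for the inhomogeneous equation `e' = -a e + q` on `[0, 1]`. -/
theorem norm_le_of_linear_ode {a q e : ℝ → R} {δ ε : ℝ} (hδ : 0 ≤ δ) (hε : 0 ≤ ε)
    (ha : ∀ t ∈ Icc (0 : ℝ) 1, ‖a t‖ ≤ 1) (hq : ∀ t ∈ Icc (0 : ℝ) 1, ‖q t‖ ≤ ε)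
    (he : ∀ t ∈ Icc (0 : ℝ) 1, HasDerivWithinAt e (-(a t * e t) + q t) (Icc 0 1) t)
    (he0 : ‖e 0‖ ≤ δ) {t : ℝ} (ht : t ∈ Icc (0 : ℝ) 1) : ‖e t‖ ≤ 3 * (δ + ε) := by
  have h := norm_le_gronwallBound_of_norm_deriv_right_le (δ := δ) (K := 1) (ε := ε)
    (fun s hs => (he s hs).continuousWithinAt)
    (fun s hs => (he s (Ico_subset_Icc_self hs)).mono_of_mem_nhdsWithin
      (mem_nhdsWithin.2 ⟨Iio 1, isOpen_Iio, hs.2, fun y hy => ⟨hs.1.trans hy.2, hy.1.le⟩⟩)) he0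
    (fun s hs => by
      have hs' := Ico_subset_Icc_self hs
      refine (norm_add_le _ _).trans (add_le_add ?_ (hq s hs'))
      rw [norm_neg]
      exact (norm_mul_le _ _).trans (mul_le_mul_of_nonneg_right (ha s hs') (norm_nonneg _))) t ht
  rw [gronwallBound_of_K_ne_0 one_ne_zero] at h
  -- The constant `3` in the conclusion is an upper bound for `e`, the largest value of the
  -- exponential on `[0, 1]`.
  have h3 : Real.exp (1 * (t - 0)) ≤ 3 := by
    have : Real.exp (1 * (t - 0)) ≤ Real.exp 1 := Real.exp_le_exp.2 (by linarith [ht.2])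
    linarith [Real.exp_one_lt_d9]
  have h1 : 0 ≤ Real.exp (1 * (t - 0)) := (Real.exp_pos _).le
  nlinarith

/-- The candidate derivative of the radial transport is a second order approximation. -/
theorem radial_transport_estimate {Ω : E → E →L[ℝ] R} {r C : ℝ} (hr : r ≤ 1) (hC : 0 ≤ C)
    (hCr : C * r ≤ 1)
    (hd : ∀ z ∈ ball (0 : E) r, DifferentiableAt ℝ Ω z)
    (h0 : ∀ z ∈ ball (0 : E) r, ‖Ω z‖ ≤ C) (h1 : ∀ z ∈ ball (0 : E) r, ‖fderiv ℝ Ω z‖ ≤ C)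
    (h2 : ∀ z ∈ ball (0 : E) r, ∀ y ∈ ball (0 : E) r,
      ‖fderiv ℝ Ω z - fderiv ℝ Ω y‖ ≤ C * ‖z - y‖)
    (flat : ∀ z ∈ ball (0 : E) r, ∀ v w, fderiv ℝ Ω z v w - fderiv ℝ Ω z w v
      + (Ω z v * Ω z w - Ω z w * Ω z v) = 0)
    {u : E → ℝ → R} (hu0 : ∀ z ∈ ball (0 : E) r, u z 0 = 1)
    (hu : ∀ z ∈ ball (0 : E) r, ∀ t ∈ Icc (0 : ℝ) 1,
      HasDerivWithinAt (u z) (-(Ω (t • z) z * u z t)) (Icc 0 1) t) :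
    ∃ K, ∀ x ∈ ball (0 : E) r, ∀ y ∈ ball (0 : E) r,
      ‖u y 1 - u x 1 + Ω x (y - x) * u x 1‖ ≤ K * ‖y - x‖ ^ 2 := by
  have mem : ∀ z ∈ ball (0 : E) r, ∀ t ∈ Icc (0 : ℝ) 1, t • z ∈ ball (0 : E) r := by
    intro z hz t ht
    rw [mem_ball_zero_iff] at hz ⊢
    rw [norm_smul, Real.norm_of_nonneg ht.1]
    exact (mul_le_of_le_one_left (norm_nonneg _) ht.2).trans_lt hz
  have ha : ∀ z ∈ ball (0 : E) r, ∀ t ∈ Icc (0 : ℝ) 1, ‖Ω (t • z) z‖ ≤ 1 := by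
    intro z hz t ht
    refine ((Ω (t • z)).le_opNorm z).trans (le_trans ?_ hCr)
    exact mul_le_mul (h0 _ (mem z hz t ht)) (mem_ball_zero_iff.1 hz).le (norm_nonneg _) hC
  set N : ℝ := 3 * (‖(1 : R)‖ + 0) with hN
  have hN0 : 0 ≤ N := by positivity
  have ub : ∀ z ∈ ball (0 : E) r, ∀ t ∈ Icc (0 : ℝ) 1, ‖u z t‖ ≤ N := by
    intro z hz t ht
    refine norm_le_of_linear_ode (a := fun t => Ω (t • z) z) (q := fun _ => 0) (norm_nonneg _)
      le_rfl (ha z hz) (by simp) (fun s hs => ?_) (by rw [hu0 z hz]) ht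
    simpa using hu z hz s hs
  have lip : ∀ z ∈ ball (0 : E) r, ∀ y ∈ ball (0 : E) r, ‖Ω y - Ω z‖ ≤ C * ‖y - z‖ := by
    intro z hz y hy
    exact (convex_ball (0 : E) r).norm_image_sub_le_of_norm_fderiv_le hd h1 hz hy
  have taylor : ∀ z ∈ ball (0 : E) r, ∀ y ∈ ball (0 : E) r,
      ‖Ω y - Ω z - fderiv ℝ Ω z (y - z)‖ ≤ C * ‖y - z‖ ^ 2 := by
    intro z hz y hy
    have := (convex_segment z y).norm_image_sub_le_of_norm_fderiv_le' (f := Ω)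
      (φ := fderiv ℝ Ω z) (C := C * ‖y - z‖)
      (fun w hw => hd w ((convex_ball (0 : E) r).segment_subset hz hy hw))
      (fun w hw => (h2 w ((convex_ball (0 : E) r).segment_subset hz hy hw) z hz).trans
        (mul_le_mul_of_nonneg_left (norm_sub_le_of_mem_segment hw) hC))
      (left_mem_segment ℝ z y) (right_mem_segment ℝ z y)
    rwa [pow_two, ← mul_assoc]
  -- The factor `3` is Grönwall's; the bracket is the bound, divided by `‖y - x‖ ^ 2`, for the
  -- forcing term `q` in the final estimate.
  refine ⟨3 * (2 * C * N + 2 * C * (6 * C * N)), fun x hx y hy => ?_⟩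
  set h := y - x with hh
  have hty : ∀ t : ℝ, t • y - t • x = t • h := fun t => by rw [hh, smul_sub]
  have tn : ∀ t ∈ Icc (0 : ℝ) 1, ‖t • h‖ ≤ ‖h‖ := fun t ht => by
    rw [norm_smul, Real.norm_of_nonneg ht.1]
    exact mul_le_of_le_one_left (norm_nonneg _) ht.2
  have hx1 : ‖x‖ ≤ 1 := (mem_ball_zero_iff.1 hx).le.trans hr
  have hn := norm_nonneg h
  have lipt : ∀ t ∈ Icc (0 : ℝ) 1, ‖Ω (t • y) - Ω (t • x)‖ ≤ C * ‖h‖ := by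
    intro t ht
    refine (lip _ (mem x hx t ht) _ (mem y hy t ht)).trans ?_
    rw [hty]
    exact mul_le_mul_of_nonneg_left (tn t ht) hC
  have dec : ∀ t : ℝ, Ω (t • y) y - Ω (t • x) x
      = Ω (t • y) h + (Ω (t • y) - Ω (t • x)) x := fun t => by simp [hh]
  have diffa : ∀ t ∈ Icc (0 : ℝ) 1, ‖Ω (t • y) y - Ω (t • x) x‖ ≤ 2 * C * ‖h‖ := by
    intro t ht
    rw [dec]
    have e1 := (Ω (t • y)).le_of_opNorm_le (h0 _ (mem y hy t ht)) h
    have e2 := (Ω (t • y) - Ω (t • x)).le_of_opNorm_le (lipt t ht) x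
    have e3 : C * ‖h‖ * ‖x‖ ≤ C * ‖h‖ := mul_le_of_le_one_right (by positivity) hx1
    linarith [norm_add_le (Ω (t • y) h) ((Ω (t • y) - Ω (t • x)) x)]
  have du : ∀ t ∈ Icc (0 : ℝ) 1, ‖u y t - u x t‖ ≤ 6 * C * N * ‖h‖ := by
    intro t ht
    have := norm_le_of_linear_ode (a := fun t => Ω (t • y) y)
      (q := fun t => -((Ω (t • y) y - Ω (t • x) x) * u x t)) (e := fun t => u y t - u x t)
      (δ := 0) (ε := 2 * C * ‖h‖ * N) le_rfl (by positivity) (ha y hy)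
      (fun s hs => by
        rw [norm_neg]
        exact (norm_mul_le _ _).trans (mul_le_mul (diffa s hs) (ub x hx s hs) (norm_nonneg _)
          (by positivity)))
      (fun s hs => by
        refine ((hu y hy s hs).sub (hu x hx s hs)).congr_deriv ?_
        noncomm_ring)
      (by simp [hu0 y hy, hu0 x hx]) ht
    linarith
  -- `L t` is the derivative of `y ↦ Ω (t • y) y` at `x` in the direction `h`.
  set L : ℝ → R := fun t => Ω (t • x) h + t • fderiv ℝ Ω (t • x) h x with hL
  have hLn : ∀ t ∈ Icc (0 : ℝ) 1, ‖L t‖ ≤ 2 * C * ‖h‖ := by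
    intro t ht
    have e1 := (Ω (t • x)).le_of_opNorm_le (h0 _ (mem x hx t ht)) h
    have e2 : ‖t • fderiv ℝ Ω (t • x) h x‖ ≤ C * ‖h‖ := by
      rw [norm_smul, Real.norm_of_nonneg ht.1]
      refine (mul_le_of_le_one_left (norm_nonneg _) ht.2).trans ?_
      refine ((fderiv ℝ Ω (t • x) h).le_of_opNorm_le
        ((fderiv ℝ Ω (t • x)).le_of_opNorm_le (h1 _ (mem x hx t ht)) h) x).trans ?_
      exact mul_le_of_le_one_right (by positivity) hx1
    linarith [norm_add_le (Ω (t • x) h) (t • fderiv ℝ Ω (t • x) h x)]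
  have hrem : ∀ t ∈ Icc (0 : ℝ) 1,
      ‖Ω (t • y) y - Ω (t • x) x - L t‖ ≤ 2 * C * ‖h‖ ^ 2 := by
    intro t ht
    have : Ω (t • y) y - Ω (t • x) x - L t = (Ω (t • y) - Ω (t • x)) h
        + (Ω (t • y) - Ω (t • x) - fderiv ℝ Ω (t • x) (t • y - t • x)) x := by
      rw [hty]
      simp [hh, hL]
      abel
    rw [this]
    have e1 := (Ω (t • y) - Ω (t • x)).le_of_opNorm_le (lipt t ht) h
    have e2 := (Ω (t • y) - Ω (t • x) - fderiv ℝ Ω (t • x) (t • y - t • x)).le_of_opNorm_le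
      (taylor _ (mem x hx t ht) _ (mem y hy t ht)) x
    rw [hty] at e2 ⊢
    have e3 : C * ‖t • h‖ ^ 2 * ‖x‖ ≤ C * ‖h‖ ^ 2 := by
      refine (mul_le_of_le_one_right (by positivity) hx1).trans ?_
      exact mul_le_mul_of_nonneg_left (pow_le_pow_left₀ (norm_nonneg _) (tn t ht) 2) hC
    refine (norm_add_le _ _).trans ?_
    nlinarith
  have hΩd : ∀ t ∈ Icc (0 : ℝ) 1, HasDerivWithinAt (fun s : ℝ => Ω (s • x) h)
      (fderiv ℝ Ω (t • x) x h) (Icc 0 1) t := by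
    intro t ht
    have e1 : HasDerivAt (fun s : ℝ => s • x) x t := by
      simpa using (hasDerivAt_id t).smul_const x
    have e2 := (hd _ (mem x hx t ht)).hasFDerivAt.comp_hasDerivAt t e1
    exact ((ContinuousLinearMap.apply ℝ R h).hasFDerivAt.comp_hasDerivAt t e2).hasDerivWithinAt
  -- The quantity `e = u y - u x + t Ω(t x) h u x` measures the failure of the transport equation in
  -- the direction `h` along the ray. It vanishes at `0`, and by flatness it solves the same linear
  -- equation as `u x` up to a forcing term quadratic in `h`. At `t = 1` this is the claim.
  have key := norm_le_of_linear_ode (a := fun t => Ω (t • x) x)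
      (q := fun t => -((Ω (t • y) y - Ω (t • x) x - L t) * u y t) - L t * (u y t - u x t))
      (e := fun t => u y t - u x t + t • (Ω (t • x) h * u x t))
      (δ := 0) (ε := 2 * C * ‖h‖ ^ 2 * N + 2 * C * ‖h‖ * (6 * C * N * ‖h‖))
      le_rfl (by positivity) (ha x hx)
      (fun s hs => by
        refine (norm_sub_le _ _).trans (add_le_add ?_ ?_)
        · rw [norm_neg]
          exact (norm_mul_le _ _).trans (mul_le_mul (hrem s hs) (ub y hy s hs) (norm_nonneg _)
            (by positivity))
        · exact (norm_mul_le _ _).trans (mul_le_mul (hLn s hs) (du s hs) (norm_nonneg _)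
            (by positivity)))
      (fun s hs => by
        refine (((hu y hy s hs).sub (hu x hx s hs)).add
          ((hasDerivWithinAt_id s _).smul ((hΩd s hs).mul (hu x hx s hs)))).congr_deriv ?_
        have fl : fderiv ℝ Ω (s • x) x h = fderiv ℝ Ω (s • x) h x
            - (Ω (s • x) x * Ω (s • x) h - Ω (s • x) h * Ω (s • x) x) := by
          rw [← sub_eq_zero, ← flat _ (mem x hx s hs) x h]
          abel
        simp only [hL, fl, id, one_smul, mul_add, add_mul, sub_mul, mul_sub, smul_add, smul_sub,
          smul_neg, mul_neg, mul_smul_comm, smul_mul_assoc, mul_assoc]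
        abel)
      (by simp [hu0 y hy, hu0 x hx]) (right_mem_Icc.2 zero_le_one)
  simp only [one_smul] at key
  refine key.trans (le_of_eq ?_)
  ring

theorem ContinuousAt.eventually_norm_le_add_one {X G : Type*} [TopologicalSpace X]
    [NormedAddCommGroup G] {f : X → G} {x : X} (hf : ContinuousAt f x) :
    ∀ᶠ z in 𝓝 x, ‖f z‖ ≤ ‖f x‖ + 1 :=
  (hf.norm.eventually_lt_const (lt_add_one _)).mono fun _ h => h.le

/-- Uniform bounds for a `C²` map and its derivative near a point. -/
theorem ContDiffAt.exists_ball_bounds {G : Type*} [NormedAddCommGroup G] [NormedSpace ℝ G]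
    {f : E → G} {x : E} (hf : ContDiffAt ℝ 2 f x) :
    ∃ C > 0, ∀ᶠ ρ in 𝓝[>] (0 : ℝ), (∀ z ∈ ball x ρ, DifferentiableAt ℝ f z) ∧
      (∀ z ∈ ball x ρ, ‖f z‖ ≤ C) ∧ (∀ z ∈ ball x ρ, ‖fderiv ℝ f z‖ ≤ C) ∧
      ∀ z ∈ ball x ρ, ∀ y ∈ ball x ρ, ‖fderiv ℝ f z - fderiv ℝ f y‖ ≤ C * ‖z - y‖ := by
  have hfd : ContDiffAt ℝ 1 (fderiv ℝ f) x := hf.fderiv_right (by norm_num)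
  obtain ⟨K, t, ht, hK⟩ := hfd.exists_lipschitzOnWith
  have bd : ∀ᶠ z in 𝓝 x, DifferentiableAt ℝ f z :=
    (hf.eventually (by simp)).mono fun _ h => h.differentiableAt (by simp)
  obtain ⟨ρ, hρ, hρs⟩ := Metric.eventually_nhds_iff_ball.1
    (((hf.continuousAt.eventually_norm_le_add_one.and
      hfd.continuousAt.eventually_norm_le_add_one).and bd).and
      (show ∀ᶠ z in 𝓝 x, z ∈ t from ht))
  refine ⟨max (max (‖f x‖ + 1) (‖fderiv ℝ f x‖ + 1)) K,
    lt_of_lt_of_le (by positivity) ((le_max_left _ _).trans (le_max_left _ _)), ?_⟩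
  filter_upwards [Ioo_mem_nhdsGT hρ] with r hr
  have hsub : ball x r ⊆ ball x ρ := ball_subset_ball hr.2.le
  refine ⟨fun z hz => (hρs z (hsub hz)).1.2,
    fun z hz => (hρs z (hsub hz)).1.1.1.trans ((le_max_left _ _).trans (le_max_left _ _)),
    fun z hz => (hρs z (hsub hz)).1.1.2.trans ((le_max_right _ _).trans (le_max_left _ _)),
    fun z hz y hy => ?_⟩
  have := hK.dist_le_mul z (hρs z (hsub hz)).2 y (hρs y (hsub hy)).2
  rw [dist_eq_norm, dist_eq_norm] at this
  exact this.trans (mul_le_mul_of_nonneg_right (le_max_right _ _) (norm_nonneg _))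

/-- A flat connection form admits a parallel transport from the centre, on a small ball. -/
theorem exists_flat_transport [CompleteSpace R] {Ω : E → E →L[ℝ] R} {s : Set E} (hs : s ∈ 𝓝 0)
    (hΩ : ContDiffOn ℝ ∞ Ω s)
    (flat : ∀ z ∈ s, ∀ v w, fderiv ℝ Ω z v w - fderiv ℝ Ω z w v
      + (Ω z v * Ω z w - Ω z w * Ω z v) = 0) :
    ∃ r > 0, ball (0 : E) r ⊆ s ∧ ∃ g : E → R, g 0 = 1 ∧ ∀ z ∈ ball (0 : E) r,
      HasFDerivAt g (-(((ContinuousLinearMap.mul ℝ R).flip (g z)).comp (Ω z))) z := by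
  have hΩ0 : ContDiffAt ℝ ∞ Ω 0 := hΩ.contDiffAt hs
  obtain ⟨C, hC0, hC⟩ := (hΩ0.of_le (WithTop.coe_le_coe.2 le_top) :
    ContDiffAt ℝ 2 Ω 0).exists_ball_bounds
  obtain ⟨ρ', hρ', hρs'⟩ := Metric.mem_nhds_iff.1 hs
  -- The radius is below `1`, below that of a ball inside `s`, and so small that the coefficients `Ω
  -- (t • z) z`, bounded by `C * r`, meet the smallness condition of the existence lemma.
  obtain ⟨r, ⟨hd, h0, h1, h2⟩, hr⟩ := (hC.and (Ioo_mem_nhdsGT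
    (lt_min (lt_min hρ' one_pos) (by positivity : 0 < 1 / (C * (‖(1 : R)‖ + 1)))))).exists
  have hr0 : 0 < r := hr.1
  have hr1 : r ≤ 1 := hr.2.le.trans ((min_le_left _ _).trans (min_le_right _ _))
  have hsub : ball (0 : E) r ⊆ s :=
    (ball_subset_ball (hr.2.le.trans ((min_le_left _ _).trans (min_le_left _ _)))).trans hρs'
  have hCr : C * r * (‖(1 : R)‖ + 1) ≤ 1 := by
    have : r ≤ 1 / (C * (‖(1 : R)‖ + 1)) := hr.2.le.trans (min_le_right _ _)
    rw [le_div_iff₀ (by positivity)] at this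
    linarith
  have hCr' : C * r ≤ 1 := by
    have : 0 ≤ C * r * ‖(1 : R)‖ := by positivity
    linarith
  have mem : ∀ z ∈ ball (0 : E) r, ∀ t ∈ Icc (0 : ℝ) 1, t • z ∈ ball (0 : E) r := by
    intro z hz t ht
    rw [mem_ball_zero_iff] at hz ⊢
    rw [norm_smul, Real.norm_of_nonneg ht.1]
    exact (mul_le_of_le_one_left (norm_nonneg _) ht.2).trans_lt hz
  have sol : ∀ z ∈ ball (0 : E) r, ∃ u : ℝ → R, u 0 = 1 ∧ ∀ t ∈ Icc (0 : ℝ) 1,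
      HasDerivWithinAt u (-(Ω (t • z) z * u t)) (Icc 0 1) t := by
    intro z hz
    refine exists_linear_ode_solution (κ := C * r) (fun t ht => ?_) (fun t ht => ?_) hCr
    · have e1 : ContinuousAt (fun t : ℝ => Ω (t • z)) t :=
        ContinuousAt.comp (f := fun t : ℝ => t • z) (hd _ (mem z hz t ht)).continuousAt
          (by fun_prop)
      exact (e1.clm_apply continuousAt_const).continuousWithinAt
    · exact ((Ω (t • z)).le_opNorm z).trans
        (mul_le_mul (h0 _ (mem z hz t ht)) (mem_ball_zero_iff.1 hz).le (norm_nonneg _) hC0.le)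
  choose! u hu0 hu using sol
  obtain ⟨B, hB⟩ := radial_transport_estimate hr1 hC0.le hCr' hd h0 h1 h2
    (fun z hz => flat z (hsub hz)) hu0 hu
  refine ⟨r, hr0, hsub, fun z => u z 1, ?_, fun z hz => ?_⟩
  -- At the centre the coefficient `Ω (t • 0) 0` vanishes, so the solution stays equal to `1`.
  · have := norm_le_of_linear_ode (a := fun _ => 0) (q := fun _ => 0)
      (e := fun t => u (0 : E) t - 1) le_rfl le_rfl (by simp) (by simp)
      (fun t ht => by simpa using (hu 0 (by simpa using hr0) t ht).sub_const 1)
      (by simp [hu0 0 (by simpa using hr0)]) (right_mem_Icc.2 zero_le_one)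
    simpa [sub_eq_zero] using this
  · rw [hasFDerivAt_iff_isLittleO]
    refine Asymptotics.IsBigO.trans_isLittleO (g := fun y => ‖y - z‖ ^ 2)
      (Asymptotics.IsBigO.of_bound B ?_) ?_
    · filter_upwards [isOpen_ball.mem_nhds hz] with y hy
      have := hB z hz y hy
      rw [Real.norm_of_nonneg (by positivity)]
      refine (le_of_eq (congrArg _ ?_)).trans this
      exact sub_neg_eq_add (u y 1 - u z 1) (Ω z (y - z) * u z 1)
    · have : (fun h : E => ‖h‖ ^ 2) =o[𝓝 0] fun h : E => h :=
        Asymptotics.isLittleO_norm_pow_id one_lt_two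
      have h3 : Tendsto (fun y : E => y - z) (𝓝 z) (𝓝 0) := by
        have : ContinuousAt (fun y : E => y - z) z := by fun_prop
        simpa [ContinuousAt] using this
      exact this.comp_tendsto h3

/-- The smooth invertible gauge transformation that trivializes a flat connection form. -/
theorem exists_flat_gauge [CompleteSpace R] {Ω : E → E →L[ℝ] R} {z₀ : E} {s : Set E}
    (hs : s ∈ 𝓝 z₀) (hΩ : ContDiffOn ℝ ∞ Ω s)
    (flat : ∀ z ∈ s, ∀ v w, fderiv ℝ Ω z v w - fderiv ℝ Ω z w v
      + (Ω z v * Ω z w - Ω z w * Ω z v) = 0) :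
    ∃ r > 0, ball z₀ r ⊆ s ∧ ∃ g : E → R, ContDiffOn ℝ ∞ g (ball z₀ r) ∧
      (∀ z ∈ ball z₀ r, IsUnit (g z)) ∧
      ∀ z ∈ ball z₀ r, ∀ v, fderiv ℝ g z v = -(Ω z v * g z) := by
  have hsh : ContDiff ℝ ∞ fun z : E => z₀ + z := by fun_prop
  have hs' : (fun z => z₀ + z) ⁻¹' s ∈ 𝓝 (0 : E) :=
    (continuous_const.add continuous_id).continuousAt.preimage_mem_nhds (by simpa using hs)
  obtain ⟨r, hr, hrs, g, hg0, hg⟩ := exists_flat_transport (Ω := fun z => Ω (z₀ + z)) hs'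
    (hΩ.comp hsh.contDiffOn (fun z hz => hz))
    (fun z hz v w => by
      rw [fderiv_comp_add_left]
      exact flat _ hz v w)
  have hG : ∀ z ∈ ball z₀ r, HasFDerivAt (fun z => g (z - z₀))
      (-(((ContinuousLinearMap.mul ℝ R).flip (g (z - z₀))).comp (Ω z))) z := by
    intro z hz
    have h1 : HasFDerivAt (fun z : E => z - z₀) (ContinuousLinearMap.id ℝ E) z :=
      (hasFDerivAt_id z).sub_const z₀
    have h2 := (hg (z - z₀) (by simpa [dist_eq_norm] using hz)).comp z h1
    rw [ContinuousLinearMap.comp_id, add_sub_cancel] at h2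
    exact h2
  have hu : ∀ᶠ z in 𝓝 z₀, IsUnit (g (z - z₀)) := by
    have hc : ContinuousAt (fun z => g (z - z₀)) z₀ := (hG z₀ (by simpa using hr)).continuousAt
    have hone : IsUnit (g (z₀ - z₀)) := by simp [hg0]
    exact hc.preimage_mem_nhds (Units.isOpen.mem_nhds hone)
  obtain ⟨ρ, hρ, hρu⟩ := Metric.eventually_nhds_iff_ball.1 hu
  have hbs : ball z₀ r ⊆ s := fun z hz => by
    simpa using hrs (show z - z₀ ∈ ball (0 : E) r by simpa [dist_eq_norm] using hz)
  -- Bootstrapping: the derivative of `g` is a bilinear expression in `g` and the smooth `Ω`, so `g`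
  -- of class `C^n` is of class `C^(n+1)`.
  have smooth : ContDiffOn ℝ ∞ (fun z => g (z - z₀)) (ball z₀ r) := by
    rw [contDiffOn_infty]
    intro n
    induction n with
    | zero =>
      exact contDiffOn_zero.2 fun z hz => (hG z hz).continuousAt.continuousWithinAt
    | succ n ih =>
      rw [show ((n + 1 : ℕ) : ℕ∞ω) = (n : ℕ∞ω) + 1 by push_cast; rfl,
        contDiffOn_succ_iff_fderiv_of_isOpen isOpen_ball]
      refine ⟨fun z hz => (hG z hz).differentiableAt.differentiableWithinAt, by simp, ?_⟩
      have h3 : ContDiffOn ℝ n Ω (ball z₀ r) :=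
        (hΩ.mono hbs).of_le (by exact_mod_cast le_top)
      have h4 : ContDiffOn ℝ n (fun z =>
          -(((ContinuousLinearMap.mul ℝ R).flip (g (z - z₀))).comp (Ω z))) (ball z₀ r) :=
        (((ContinuousLinearMap.mul ℝ R).flip.contDiff.comp_contDiffOn ih).clm_comp h3).neg
      exact h4.congr fun z hz => (hG z hz).fderiv
  refine ⟨min r ρ, lt_min hr hρ, (ball_subset_ball (min_le_left _ _)).trans hbs,
    fun z => g (z - z₀), smooth.mono (ball_subset_ball (min_le_left _ _)),
    fun z hz => hρu z (ball_subset_ball (min_le_right _ _) hz), fun z hz v => ?_⟩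
  rw [(hG z (ball_subset_ball (min_le_left _ _) hz)).fderiv]
  simp

end FlatTransport

/-! ### Curvature of the connection and parallel torsion -/

section Curvature

variable {E : Type*} [NormedAddCommGroup E] [NormedSpace ℝ E] [FiniteDimensional ℝ E]
  {M : Type*} [TopologicalSpace M] [T2Space M] [ChartedSpace E M] [IsManifold 𝓘(ℝ, E) ∞ M]
  {F : Type*} [NormedAddCommGroup F] [NormedSpace ℝ F]
  {V : M → Type*} [TopologicalSpace (TotalSpace F V)]
  [∀ x, AddCommGroup (V x)] [∀ x, Module ℝ (V x)] [∀ x, TopologicalSpace (V x)]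
  [∀ x, IsTopologicalAddGroup (V x)] [∀ x, ContinuousSMul ℝ (V x)]
  [FiberBundle F V] [VectorBundle ℝ F V]

/-- The value at `x` of `∇_W ∇_W' Z - ∇_W' ∇_W Z - ∇_[W, W'] Z`. -/
noncomputable def SmoothConnection.curvatureAt (D : SmoothConnection 𝓘(ℝ, E) F V)
    (W W' : Cₛ^∞⟮𝓘(ℝ, E); E, (TangentSpace 𝓘(ℝ, E) : M → Type _)⟯)
    (Z : Cₛ^∞⟮𝓘(ℝ, E); F, V⟯) (x : M) : V x :=
  D.along W (D.along W' Z) x - D.along W' (D.along W Z) x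
    - D.toFun Z x (VectorField.mlieBracket 𝓘(ℝ, E) W W' x)

theorem SmoothConnection.curvatureAt_swap (D : SmoothConnection 𝓘(ℝ, E) F V)
    (W W' : Cₛ^∞⟮𝓘(ℝ, E); E, (TangentSpace 𝓘(ℝ, E) : M → Type _)⟯)
    (Z : Cₛ^∞⟮𝓘(ℝ, E); F, V⟯) (x : M) : D.curvatureAt W W' Z x = -D.curvatureAt W' W Z x := by
  simp only [curvatureAt]
  rw [VectorField.mlieBracket_swap_apply, map_neg]
  abel

/-- Replacing `W` by `f W` produces a term with `df(W')` from `∇_W' (f ∇_W Z)`; it is cancelled by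
the one from `[f W, W'] = f [W, W'] - df(W') W`. -/
theorem SmoothConnection.curvatureAt_eq_of_apply_eq [IsManifold 𝓘(ℝ, E) 2 M]
    (D : SmoothConnection 𝓘(ℝ, E) F V)
    {W W₁ : Cₛ^∞⟮𝓘(ℝ, E); E, (TangentSpace 𝓘(ℝ, E) : M → Type _)⟯}
    (W' : Cₛ^∞⟮𝓘(ℝ, E); E, (TangentSpace 𝓘(ℝ, E) : M → Type _)⟯)
    (Z : Cₛ^∞⟮𝓘(ℝ, E); F, V⟯) {x : M} (h : W x = W₁ x) :
    D.curvatureAt W W' Z x = D.curvatureAt W₁ W' Z x := by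
  refine map_eq_of_apply_eq (F := E) (V := (TangentSpace 𝓘(ℝ, E) : M → Type _))
    (AddMonoidHom.mk' (fun W => D.curvatureAt W W' Z x) fun W₁ W₂ => ?_) (fun f hf W => ?_) h
  · simp only [curvatureAt]
    have := VectorField.mlieBracket_add_left (I := 𝓘(ℝ, E)) (W := W') W₁.mdifferentiableAt
      W₂.mdifferentiableAt (x := x)
    rw [ContMDiffSection.coe_add, this, D.add_along, D.add_along, D.along_add, map_add]
    simp only [ContMDiffSection.coe_add, Pi.add_apply]
    abel
  · simp only [curvatureAt, AddMonoidHom.mk'_apply]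
    have := VectorField.mlieBracket_smul_left (I := 𝓘(ℝ, E)) (W := W') (V := W) (x := x)
      ((hf x).mdifferentiableAt (by simp)) W.mdifferentiableAt
    rw [show (⇑(smulSection f hf W) : ∀ y, TangentSpace 𝓘(ℝ, E) y) = f • ⇑W from rfl, this,
      D.smulSection_along, D.smulSection_along, D.along_smulSection, map_add, map_smul, map_smul]
    simp only [smulSection_apply, smul_sub, neg_smul, D.along_apply W Z x]
    abel

namespace LieAlgebroid

variable (A : LieAlgebroid 𝓘(ℝ, E) F V) (D : SmoothConnection 𝓘(ℝ, E) F V)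

theorem bracket_swap (X Y : Cₛ^∞⟮𝓘(ℝ, E); F, V⟯) : A.bracket X Y = -A.bracket Y X := by
  have := A.bracket_self (X + Y)
  simp only [map_add, LinearMap.add_apply, A.bracket_self, zero_add, add_zero] at this
  rw [add_comm] at this
  exact eq_neg_of_add_eq_zero_left this

theorem anchorSection_add (X Y : Cₛ^∞⟮𝓘(ℝ, E); F, V⟯) :
    A.anchorSection (X + Y) = A.anchorSection X + A.anchorSection Y := by
  ext x
  exact map_add (A.anchor x) (X x) (Y x)

theorem anchorSection_sub (X Y : Cₛ^∞⟮𝓘(ℝ, E); F, V⟯) :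
    A.anchorSection (X - Y) = A.anchorSection X - A.anchorSection Y := by
  ext x
  exact map_sub (A.anchor x) (X x) (Y x)

theorem anchorSection_smulSection {f : M → ℝ} (hf : ContMDiff 𝓘(ℝ, E) 𝓘(ℝ, ℝ) ∞ f)
    (X : Cₛ^∞⟮𝓘(ℝ, E); F, V⟯) :
    A.anchorSection (smulSection f hf X) = smulSection f hf (A.anchorSection X) := by
  ext x
  exact map_smul (A.anchor x) (f x) (X x)

theorem smulSection_bracket {f : M → ℝ} (hf : ContMDiff 𝓘(ℝ, E) 𝓘(ℝ, ℝ) ∞ f)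
    (X Y : Cₛ^∞⟮𝓘(ℝ, E); F, V⟯) (x : M) :
    A.bracket (smulSection f hf X) Y x
      = f x • A.bracket X Y x - mvfderiv 𝓘(ℝ, E) f x (A.anchor x (Y x)) • X x := by
  rw [A.bracket_swap, A.bracket_swap X Y]
  change -(A.bracket Y (smulSection f hf X) x) = f x • -(A.bracket Y X x) - _
  rw [A.bracket_smul]
  module

/-- With a cutoff `ψ` supported where `Y` vanishes, `ψ Y = 0`; expanding `[X, ψ Y]` at `x`, where `ψ
= 1` and `Y = 0`, leaves `[X, Y]`. -/
theorem bracket_apply_eq_zero (X : Cₛ^∞⟮𝓘(ℝ, E); F, V⟯) {Y : Cₛ^∞⟮𝓘(ℝ, E); F, V⟯} {x : M}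
    (h : ∀ᶠ y in 𝓝 x, Y y = 0) : A.bracket X Y x = 0 := by
  obtain ⟨ψ, hψ, h1, hs⟩ := exists_smooth_cutoff (E := E) h
  have h0 : smulSection ψ hψ Y = 0 := by
    ext y
    by_cases hy : Y y = 0
    · simp [hy]
    · simp [image_eq_zero_of_notMem_tsupport fun h => hy (hs h)]
  have := A.bracket_smul X ψ hψ Y x
  rw [h0, map_zero, h1.self_of_nhds, h.self_of_nhds] at this
  simpa using this.symm

/-- The bracket is a local operator. -/
theorem bracket_congr {X X' Y Y' : Cₛ^∞⟮𝓘(ℝ, E); F, V⟯} {x : M} (hX : ∀ᶠ y in 𝓝 x, X y = X' y)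
    (hY : ∀ᶠ y in 𝓝 x, Y y = Y' y) : A.bracket X Y x = A.bracket X' Y' x := by
  have h1 := A.bracket_apply_eq_zero X (Y := Y - Y') (hY.mono fun y hy => by simp [hy])
  have h2 := A.bracket_apply_eq_zero Y' (Y := X - X') (hX.mono fun y hy => by simp [hy])
  rw [map_sub] at h1 h2
  rw [A.bracket_swap Y' X, A.bracket_swap Y' X'] at h2
  have h3 : A.bracket X Y x = A.bracket X Y' x := sub_eq_zero.1 h1
  have h4 : -(A.bracket X Y' x) = -(A.bracket X' Y' x) := sub_eq_zero.1 h2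
  rw [h3, neg_injective h4]

theorem torsion_bar (X Y : Cₛ^∞⟮𝓘(ℝ, E); F, V⟯) : A.torsion (A.bar D) X Y
    = D.along (A.anchorSection Y) X - D.along (A.anchorSection X) Y + A.bracket X Y := by
  simp only [torsion, bar]
  rw [A.bracket_swap Y X]
  abel

theorem torsion_bar_swap (X Y : Cₛ^∞⟮𝓘(ℝ, E); F, V⟯) :
    A.torsion (A.bar D) X Y = -A.torsion (A.bar D) Y X := by
  rw [torsion_bar, torsion_bar, A.bracket_swap Y X]
  abel

/-- In `∇_{#Y} X - ∇_{#X} Y + [X, Y]` the derivatives of a factor `f` of `X` cancel between the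
first and last terms; antisymmetry handles the other slot. -/
theorem torsion_bar_eq_of_apply_eq [FiniteDimensional ℝ F] [ContMDiffVectorBundle ∞ F V 𝓘(ℝ, E)]
    {X X' Y Y' : Cₛ^∞⟮𝓘(ℝ, E); F, V⟯} {x : M} (hX : X x = X' x) (hY : Y x = Y' x) :
    A.torsion (A.bar D) X Y x = A.torsion (A.bar D) X' Y' x := by
  have left : ∀ {X X' : Cₛ^∞⟮𝓘(ℝ, E); F, V⟯} (Y : Cₛ^∞⟮𝓘(ℝ, E); F, V⟯), X x = X' x →
      A.torsion (A.bar D) X Y x = A.torsion (A.bar D) X' Y x := by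
    intro X X' Y h
    refine map_eq_of_apply_eq
      (AddMonoidHom.mk' (fun X => A.torsion (A.bar D) X Y x) fun X₁ X₂ => ?_) (fun f hf X => ?_) h
    · simp only [torsion_bar, anchorSection_add, D.along_add, D.add_along, map_add,
        LinearMap.add_apply]
      simp only [ContMDiffSection.coe_add, ContMDiffSection.coe_sub, Pi.add_apply, Pi.sub_apply]
      abel
    · simp only [AddMonoidHom.mk'_apply, torsion_bar, anchorSection_smulSection,
        D.smulSection_along, ContMDiffSection.coe_add, ContMDiffSection.coe_sub, Pi.add_apply,
        Pi.sub_apply, smulSection_apply, D.along_smulSection, A.smulSection_bracket]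
      rw [show A.anchorSection Y x = A.anchor x (Y x) from rfl]
      module
  rw [left Y hX, torsion_bar_swap, torsion_bar_swap A D X']
  exact congrArg Neg.neg (left X' hY)

/-- The curvature of `∇` along the anchor. -/
noncomputable def curvature (X Y Z : Cₛ^∞⟮𝓘(ℝ, E); F, V⟯) : Cₛ^∞⟮𝓘(ℝ, E); F, V⟯ :=
  D.along (A.anchorSection X) (D.along (A.anchorSection Y) Z)
    - D.along (A.anchorSection Y) (D.along (A.anchorSection X) Z)
    - D.along (A.anchorSection (A.bracket X Y)) Z

/-- Since `#` intertwines the brackets, the curvature along the anchor, whose tensoriality in `Z`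
comes from the Jacobi identity, is the curvature of vector fields used in charts. -/
theorem curvature_apply (X Y Z : Cₛ^∞⟮𝓘(ℝ, E); F, V⟯) (x : M) :
    A.curvature D X Y Z x = D.curvatureAt (A.anchorSection X) (A.anchorSection Y) Z x := by
  simp only [SmoothConnection.curvatureAt]
  rw [show VectorField.mlieBracket 𝓘(ℝ, E) (A.anchorSection X) (A.anchorSection Y) x
    = A.anchor x (A.bracket X Y x) from (A.anchor_bracket X Y x).symm]
  rfl

-- For `W = #Z` the operator on vector fields is induced by the one on sections: `∇̄_X (#Z) = #(∇̄_X
-- Z)`. This rewrites the Cartan identity entirely in terms of sections of the algebroid.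
variable {A D} in
theorem IsCartanConnection.along_bracket (hD : A.IsCartanConnection D)
    (X Y Z : Cₛ^∞⟮𝓘(ℝ, E); F, V⟯) :
    D.along (A.anchorSection Z) (A.bracket X Y) =
      A.bracket (D.along (A.anchorSection Z) X) Y + A.bracket X (D.along (A.anchorSection Z) Y)
        + D.along (A.anchorSection (A.bar D Y Z)) X
        - D.along (A.anchorSection (A.bar D X Z)) Y := by
  have hb : ∀ (X : Cₛ^∞⟮𝓘(ℝ, E); F, V⟯) (x : M),
      A.barTangent D X (A.anchorSection Z) x = A.anchorSection (A.bar D X Z) x := by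
    intro X x
    simp only [barTangent]
    rw [show VectorField.mlieBracket 𝓘(ℝ, E) (A.anchorSection X) (A.anchorSection Z) x
      = A.anchor x (A.bracket X Z x) from (A.anchor_bracket X Z x).symm, ← map_add]
    rfl
  ext x
  have := hD X Y (A.anchorSection Z) x
  rw [hb, hb] at this
  exact this

variable {A D} in
/-- The covariant derivative of the torsion of `∇̄` is the curvature of `∇`. -/
theorem IsCartanConnection.bar_torsion_eq_curvature (hD : A.IsCartanConnection D)
    (X Y Z : Cₛ^∞⟮𝓘(ℝ, E); F, V⟯) :
    A.bar D Z (A.torsion (A.bar D) X Y) - A.torsion (A.bar D) (A.bar D Z X) Y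
      - A.torsion (A.bar D) X (A.bar D Z Y) = A.curvature D X Y Z := by
  have h1 := hD.along_bracket Z X Y
  have h2 := hD.along_bracket Z Y X
  have j := A.jacobi Z X Y
  have s1 := A.bracket_swap X (D.along (A.anchorSection Y) Z)
  have s2 : D.along (A.anchorSection (A.bracket Y X)) Z
      = -D.along (A.anchorSection (A.bracket X Y)) Z := by
    rw [← add_eq_zero_iff_eq_neg, ← D.add_along, ← anchorSection_add, A.bracket_swap Y X,
      neg_add_cancel]
    ext x
    change D.toFun Z x (A.anchor x 0) = 0
    rw [map_zero, map_zero]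
  simp only [curvature, torsion_bar, bar, anchorSection_add, anchorSection_sub, D.along_add,
    D.add_along, D.sub_along, map_add, map_sub, LinearMap.add_apply] at *
  rw [s2] at h2
  rw [h1, h2, j, s1]
  abel

variable {A D} in
theorem IsCartanConnection.torsionIsParallel_iff (hD : A.IsCartanConnection D) :
    A.TorsionIsParallel D ↔ ∀ X Y Z, A.curvature D X Y Z = 0 := by
  simp only [TorsionIsParallel, hD.bar_torsion_eq_curvature]

theorem contMDiff_mvfderiv_apply {f : M → ℝ} (hf : ContMDiff 𝓘(ℝ, E) 𝓘(ℝ, ℝ) ∞ f)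
    (W : Cₛ^∞⟮𝓘(ℝ, E); E, (TangentSpace 𝓘(ℝ, E) : M → Type _)⟯) :
    ContMDiff 𝓘(ℝ, E) 𝓘(ℝ, ℝ) ∞ (fun x => mvfderiv 𝓘(ℝ, E) f x (W x)) :=
  (contMDiff_snd_tangentBundle_modelSpace ℝ 𝓘(ℝ, ℝ)).comp
    ((hf.contMDiff_tangentMap (m := ∞) le_rfl).comp W.contMDiff)

theorem bracket_smulSection (X : Cₛ^∞⟮𝓘(ℝ, E); F, V⟯) {f : M → ℝ}
    (hf : ContMDiff 𝓘(ℝ, E) 𝓘(ℝ, ℝ) ∞ f) (Y : Cₛ^∞⟮𝓘(ℝ, E); F, V⟯) :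
    A.bracket X (smulSection f hf Y) = smulSection f hf (A.bracket X Y)
      + smulSection _ (contMDiff_mvfderiv_apply hf (A.anchorSection X)) Y := by
  ext x
  exact A.bracket_smul X f hf Y x

theorem along_smulSection_eq (W : Cₛ^∞⟮𝓘(ℝ, E); E, (TangentSpace 𝓘(ℝ, E) : M → Type _)⟯)
    {f : M → ℝ} (hf : ContMDiff 𝓘(ℝ, E) 𝓘(ℝ, ℝ) ∞ f) (X : Cₛ^∞⟮𝓘(ℝ, E); F, V⟯) :
    D.along W (smulSection f hf X) = smulSection f hf (D.along W X)
      + smulSection _ (contMDiff_mvfderiv_apply hf W) X := by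
  ext x
  exact D.along_smulSection W hf X x

/-- The anchor acts on functions compatibly with the brackets, wherever some section is nonzero. -/
theorem mvfderiv_anchor_bracket_smul {f : M → ℝ} (hf : ContMDiff 𝓘(ℝ, E) 𝓘(ℝ, ℝ) ∞ f)
    (X Y Z : Cₛ^∞⟮𝓘(ℝ, E); F, V⟯) (x : M) :
    mvfderiv 𝓘(ℝ, E) f x (A.anchorSection (A.bracket X Y) x) • Z x =
      mvfderiv 𝓘(ℝ, E) (fun y => mvfderiv 𝓘(ℝ, E) f y (A.anchorSection Y y)) x
        (A.anchorSection X x) • Z x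
      - mvfderiv 𝓘(ℝ, E) (fun y => mvfderiv 𝓘(ℝ, E) f y (A.anchorSection X y)) x
        (A.anchorSection Y x) • Z x := by
  -- In the Jacobi identity for `f Z` the terms with one derivative of `f` cancel. Subtracting `f`
  -- times the identity for `Z` leaves the commutator of the derivations, multiplied by `Z`.
  have j := congrArg (fun S => S x) (A.jacobi X Y (smulSection f hf Z))
  have j0 := congrArg (fun S => S x) (A.jacobi X Y Z)
  simp only [bracket_smulSection, map_add] at j
  simp only [ContMDiffSection.coe_add, Pi.add_apply, smulSection_apply] at j j0
  rw [j0, smul_add] at j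
  rw [← sub_eq_zero] at j ⊢
  rw [← neg_eq_zero, ← j]
  abel

/-- The mixed first derivatives of `f` cancel, and the second derivatives cancel against the `#[X,
Y]` term by `mvfderiv_anchor_bracket_smul`. -/
theorem curvature_smulSection {f : M → ℝ} (hf : ContMDiff 𝓘(ℝ, E) 𝓘(ℝ, ℝ) ∞ f)
    (X Y Z : Cₛ^∞⟮𝓘(ℝ, E); F, V⟯) :
    A.curvature D X Y (smulSection f hf Z) = smulSection f hf (A.curvature D X Y Z) := by
  ext x
  simp only [curvature, along_smulSection_eq, D.along_add]
  simp only [ContMDiffSection.coe_add, ContMDiffSection.coe_sub, Pi.add_apply, Pi.sub_apply,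
    smulSection_apply]
  rw [A.mvfderiv_anchor_bracket_smul hf]
  simp only [smul_sub]
  abel

/-- The curvature along the anchor is tensorial in the differentiated section. -/
theorem curvature_eq_of_apply_eq [FiniteDimensional ℝ F] [ContMDiffVectorBundle ∞ F V 𝓘(ℝ, E)]
    (X Y : Cₛ^∞⟮𝓘(ℝ, E); F, V⟯) {Z Z' : Cₛ^∞⟮𝓘(ℝ, E); F, V⟯} {x : M} (h : Z x = Z' x) :
    A.curvature D X Y Z x = A.curvature D X Y Z' x := by
  refine map_eq_of_apply_eq
    (AddMonoidHom.mk' (fun Z => A.curvature D X Y Z x) fun Z₁ Z₂ => ?_) (fun f hf Z => ?_) h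
  · simp only [curvature, D.along_add]
    simp only [ContMDiffSection.coe_add, ContMDiffSection.coe_sub, Pi.add_apply, Pi.sub_apply]
    abel
  · simp only [AddMonoidHom.mk'_apply, curvature_smulSection]
    rfl

theorem curvature_apply_eq_zero {X Y Z : Cₛ^∞⟮𝓘(ℝ, E); F, V⟯} {x : M}
    (h : ∀ᶠ y in 𝓝 x, D.toFun Z y = 0) : A.curvature D X Y Z x = 0 := by
  have h1 : ∀ W : Cₛ^∞⟮𝓘(ℝ, E); E, (TangentSpace 𝓘(ℝ, E) : M → Type _)⟯,
      ∀ᶠ y in 𝓝 x, D.along W Z y = 0 := fun W => h.mono fun y hy => by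
    rw [D.along_apply, hy]
    rfl
  simp only [curvature, ContMDiffSection.coe_sub, Pi.sub_apply, D.along_apply]
  rw [D.toFun_eq_zero (h1 _), D.toFun_eq_zero (h1 _), h.self_of_nhds]
  simp

/-- A locally symmetric algebroid with connection is flat along the anchor. -/
theorem IsLocallySymmetric.curvature_eq_zero [FiniteDimensional ℝ F]
    [ContMDiffVectorBundle ∞ F V 𝓘(ℝ, E)] (h : A.IsLocallySymmetric D)
    (X Y Z : Cₛ^∞⟮𝓘(ℝ, E); F, V⟯) : A.curvature D X Y Z = 0 := by
  ext x
  obtain ⟨U, hU, hx, G, _, _, _, L, a, ⟨φ⟩⟩ := h x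
  obtain ⟨ξ, hξ⟩ := (φ.bijective x hx).2 (Z x)
  have hsm : ContMDiffOn 𝓘(ℝ, E) (𝓘(ℝ, E).prod 𝓘(ℝ, F)) ∞
      (fun y => TotalSpace.mk' F y (φ.map y ξ)) U :=
    φ.smooth.comp (contMDiffOn_id.prodMk contMDiffOn_const) fun y hy => ⟨hy, trivial⟩
  obtain ⟨Z', hZ'⟩ := exists_section_eventuallyEq hU hx hsm
  -- Tensoriality allows `Z` to be replaced by the image of a constant section through `Z x`, which
  -- is parallel near `x`.
  rw [A.curvature_eq_of_apply_eq D X Y (Z' := Z') (by rw [← hξ, hZ'.self_of_nhds])]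
  refine A.curvature_apply_eq_zero D ?_
  filter_upwards [hZ'.eventually_nhds, hU.mem_nhds hx] with y hy hyU
  rw [D.toFun_congr ((hsm.contMDiffAt (hU.mem_nhds hyU)).mdifferentiableAt (by simp)) hy]
  ext w
  have := φ.map_connection (fun _ => ξ) contMDiffOn_const y hyU w
  rw [mvfderiv_const] at this
  simpa using this

end LieAlgebroid

end Curvature

/-! ### Coordinate fields and the connection form -/

section ParallelFrames

variable {E : Type*} [NormedAddCommGroup E] [NormedSpace ℝ E] [FiniteDimensional ℝ E]
  {M : Type*} [TopologicalSpace M] [T2Space M] [ChartedSpace E M] [IsManifold 𝓘(ℝ, E) ∞ M]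
  {F : Type*} [NormedAddCommGroup F] [NormedSpace ℝ F] [FiniteDimensional ℝ F]
  {V : M → Type*} [TopologicalSpace (TotalSpace F V)]
  [∀ x, AddCommGroup (V x)] [∀ x, Module ℝ (V x)] [∀ x, TopologicalSpace (V x)]
  [∀ x, IsTopologicalAddGroup (V x)] [∀ x, ContinuousSMul ℝ (V x)]
  [FiberBundle F V] [VectorBundle ℝ F V] [ContMDiffVectorBundle ∞ F V 𝓘(ℝ, E)]

theorem mlieBracket_constant (v v' y : E) :
    VectorField.mlieBracket 𝓘(ℝ, E) (fun _ : E => v) (fun _ : E => v') y = (0 : E) := by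
  have h := VectorField.mlieBracketWithin_eq_lieBracketWithin (𝕜 := ℝ) (V := fun _ : E => v)
    (W := fun _ : E => v') (s := Set.univ)
  refine (congrFun h y).trans ?_
  simp only [VectorField.lieBracketWithin, fderivWithin_fun_const]
  exact sub_self (0 : E)

/-- Smooth global vector fields that agree near a given point with the coordinate fields. -/
theorem exists_coordinate_fields (x₀ : M) :
    ∃ W : E →ₗ[ℝ] Cₛ^∞⟮𝓘(ℝ, E); E, (TangentSpace 𝓘(ℝ, E) : M → Type _)⟯, ∀ᶠ x in 𝓝 x₀,
      (∀ v, mvfderiv 𝓘(ℝ, E) (extChartAt 𝓘(ℝ, E) x₀) x (W v x) = v) ∧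
      (∀ w, W (mvfderiv 𝓘(ℝ, E) (extChartAt 𝓘(ℝ, E) x₀) x w) x = w) ∧
      ∀ v v', VectorField.mlieBracket 𝓘(ℝ, E) (W v) (W v') x = 0 := by
  have : IsManifold 𝓘(ℝ, E) 1 M := .of_le (n := ∞) (by exact_mod_cast le_top)
  have : IsManifold 𝓘(ℝ, E) (minSmoothness ℝ 3) M := .of_le (n := ∞) <| by
    rw [minSmoothness_of_isRCLikeNormedField]
    exact WithTop.coe_le_coe.2 le_top
  obtain ⟨W, hW⟩ := exists_sections_eventuallyEq_symm (E := E) (F := E)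
    (V := (TangentSpace 𝓘(ℝ, E) : M → Type _)) x₀
  set e := trivializationAt E (TangentSpace 𝓘(ℝ, E) : M → Type _) x₀
  refine ⟨W, ?_⟩
  have hsrc : ∀ᶠ x in 𝓝 x₀, x ∈ (chartAt E x₀).source := chart_source_mem_nhds E x₀
  filter_upwards [hW.eventually_nhds, hsrc.eventually_nhds] with x hx hxs
  have hbase : x ∈ e.baseSet := hxs.self_of_nhds
  have hmf : ∀ y ∈ (chartAt E x₀).source, ∀ w : TangentSpace 𝓘(ℝ, E) y,
      mvfderiv 𝓘(ℝ, E) (extChartAt 𝓘(ℝ, E) x₀) y w = e.continuousLinearMapAt ℝ y w :=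
    fun y hy w => congrArg (fun T => T w)
      (TangentBundle.continuousLinearMapAt_trivializationAt (I := 𝓘(ℝ, E)) hy).symm
  have hWv : ∀ y ∈ (chartAt E x₀).source,
      (∀ f, W f y = e.symmL ℝ y f) → ∀ v,
      mvfderiv 𝓘(ℝ, E) (extChartAt 𝓘(ℝ, E) x₀) y (W v y) = v := fun y hy h v => by
    rw [hmf y hy, h]
    exact e.continuousLinearMapAt_symmL hy v
  refine ⟨hWv x hxs.self_of_nhds hx.self_of_nhds, fun w => ?_, fun v v' => ?_⟩
  · rw [hmf x hxs.self_of_nhds, hx.self_of_nhds]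
    exact e.symmL_continuousLinearMapAt hbase w
  -- The fields are pullbacks of constant fields under the chart, and pullback commutes with the
  -- bracket.
  · have hpull : ∀ v, ∀ᶠ y in 𝓝 x, W v y = VectorField.mpullback 𝓘(ℝ, E) 𝓘(ℝ, E)
        (extChartAt 𝓘(ℝ, E) x₀) (fun _ => v) y := by
      intro v
      filter_upwards [hx, hxs] with y hy hys
      have hi := isInvertible_mfderiv_extChartAt (I := 𝓘(ℝ, E)) (x := x₀) (y := y)
        (by simpa using hys)
      obtain ⟨T, hT⟩ := hi
      have h1 : T (W v y) = v := by
        exact (congrArg (fun T => T (W v y)) hT).trans (hWv y hys hy v)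
      have h2 : W v y = T.symm v := (T.symm_apply_eq.2 h1.symm).symm
      have h3 : (T.symm : TangentSpace 𝓘(ℝ, E) (extChartAt 𝓘(ℝ, E) x₀ y) →L[ℝ] _)
          = (mfderiv 𝓘(ℝ, E) 𝓘(ℝ, E) (extChartAt 𝓘(ℝ, E) x₀) y).inverse := by
        rw [← hT, ContinuousLinearMap.inverse_equiv]
      exact h2.trans (congrArg (fun S => S v) h3)
    have hv : ∀ v : E, MDifferentiableAt 𝓘(ℝ, E) (𝓘(ℝ, E).prod 𝓘(ℝ, E))
        (fun y => (TotalSpace.mk' E y v : TangentBundle 𝓘(ℝ, E) E)) (extChartAt 𝓘(ℝ, E) x₀ x) := by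
      intro v
      exact ((contMDiffAt_vectorSpace_iff_contDiffAt (n := 1) (V := fun _ => v)).2
        contDiffAt_const).mdifferentiableAt one_ne_zero
    rw [Filter.EventuallyEq.mlieBracket_vectorField_eq (hpull v) (hpull v'),
      ← VectorField.mpullback_mlieBracket (n := ∞) (hv v) (hv v')
        (contMDiffAt_extChartAt' (by simpa using hxs.self_of_nhds))
        (by rw [minSmoothness_of_isRCLikeNormedField]; exact WithTop.coe_le_coe.2 le_top)]
    rw [VectorField.mpullback_apply]
    refine (congrArg _ (mlieBracket_constant v v' _)).trans ?_
    exact map_zero _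

theorem mvfderiv_comp_extChartAt {G : Type*} [NormedAddCommGroup G] [NormedSpace ℝ G]
    {x₀ x : M} {h : E → G} (hx : x ∈ (extChartAt 𝓘(ℝ, E) x₀).source)
    (hh : DifferentiableAt ℝ h (extChartAt 𝓘(ℝ, E) x₀ x)) :
    MDifferentiableAt 𝓘(ℝ, E) 𝓘(ℝ, G) (fun y => h (extChartAt 𝓘(ℝ, E) x₀ y)) x ∧
    ∀ w, mvfderiv 𝓘(ℝ, E) (fun y => h (extChartAt 𝓘(ℝ, E) x₀ y)) x w
      = fderiv ℝ h (extChartAt 𝓘(ℝ, E) x₀ x)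
        (mvfderiv 𝓘(ℝ, E) (extChartAt 𝓘(ℝ, E) x₀) x w) := by
  have : IsManifold 𝓘(ℝ, E) 1 M := .of_le (n := ∞) (by exact_mod_cast le_top)
  have h1 : MDifferentiableAt 𝓘(ℝ, E) 𝓘(ℝ, E) (extChartAt 𝓘(ℝ, E) x₀) x :=
    mdifferentiableAt_extChartAt (by simpa using hx)
  have h2 : MDifferentiableAt 𝓘(ℝ, E) 𝓘(ℝ, G) h (extChartAt 𝓘(ℝ, E) x₀ x) :=
    hh.mdifferentiableAt
  refine ⟨h2.comp x h1, fun w => ?_⟩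
  have := mfderiv_comp_apply x h2 h1 w
  rw [mfderiv_eq_fderiv] at this
  exact this

/-- The connection form of `D`, read in a chart and in a local frame. If the curvature vanishes,
it satisfies the flatness equation. -/
theorem SmoothConnection.exists_connection_form (D : SmoothConnection 𝓘(ℝ, E) F V) (x₀ : M) :
    ∃ (S : F →ₗ[ℝ] Cₛ^∞⟮𝓘(ℝ, E); F, V⟯) (Ω : E → E →L[ℝ] F →L[ℝ] F) (s : Set E), IsOpen s ∧
      extChartAt 𝓘(ℝ, E) x₀ x₀ ∈ s ∧ s ⊆ (extChartAt 𝓘(ℝ, E) x₀).target ∧ ContDiffOn ℝ ∞ Ω s ∧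
      (∀ x ∈ (extChartAt 𝓘(ℝ, E) x₀).source, extChartAt 𝓘(ℝ, E) x₀ x ∈ s →
        Function.Bijective (fun f => S f x) ∧ ∀ f w, D.toFun (S f) x w
          = S (Ω (extChartAt 𝓘(ℝ, E) x₀ x)
            (mvfderiv 𝓘(ℝ, E) (extChartAt 𝓘(ℝ, E) x₀) x w) f) x) ∧
      ((∀ W W' Z x, D.curvatureAt W W' Z x = 0) → ∀ z ∈ s, ∀ v w,
        fderiv ℝ Ω z v w - fderiv ℝ Ω z w v + (Ω z v * Ω z w - Ω z w * Ω z v) = 0) := by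
  set φ := extChartAt 𝓘(ℝ, E) x₀
  set e := trivializationAt F V x₀
  have hx₀ : x₀ ∈ e.baseSet := FiberBundle.mem_baseSet_trivializationAt F V x₀
  obtain ⟨S, hS⟩ := exists_sections_eventuallyEq_symm (E := E) (F := F) (V := V) x₀
  obtain ⟨W, hW⟩ := exists_coordinate_fields (E := E) x₀
  obtain ⟨U, hU, hUo, hUx⟩ := eventually_nhds_iff.1
    ((hS.and hW).and (show ∀ᶠ x in 𝓝 x₀, x ∈ e.baseSet from e.open_baseSet.mem_nhds hx₀))
  let P : E →ₗ[ℝ] F →ₗ[ℝ] Cₛ^∞⟮𝓘(ℝ, E); F, V⟯ := LinearMap.mk₂ ℝ (fun v f => D.along (W v) (S f))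
    (fun v v' f => by rw [map_add, D.add_along])
    (fun c v f => by
      rw [map_smul]
      ext x
      exact map_smul (D.toFun (S f) x) c (W v x))
    (fun v f f' => by rw [map_add, D.along_add])
    (fun c v f => by
      rw [map_smul]
      ext x
      have := D.isCovariantDerivativeOnUniv.smul_const (σ := fun y => S f y) (x := x) c
        (S f).mdifferentiableAt
      exact congrArg (fun T => T (W v x)) this)
  have hP : ∀ v f, P v f = D.along (W v) (S f) := fun v f => rfl
  let Q : ∀ z, E →ₗ[ℝ] F →ₗ[ℝ] F := fun z => P.compr₂
    ((e.continuousLinearMapAt ℝ (φ.symm z)).toLinearMap.comp (sectionEval F V (φ.symm z)))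
  -- `Ω z v f` lists the components of `∇_{W v} (S f)` in the frame `S`, at the point with
  -- coordinates `z`.
  let Ω : E → E →L[ℝ] F →L[ℝ] F := fun z => (Q z).toContinuousBilinearMap
  have hΩ : ∀ z v f, Ω z v f = e.continuousLinearMapAt ℝ (φ.symm z) (P v f (φ.symm z)) :=
    fun z v f => rfl
  have hso : IsOpen (φ.target ∩ φ.symm ⁻¹' U) :=
    (continuousOn_extChartAt_symm x₀).isOpen_inter_preimage (isOpen_extChartAt_target x₀) hUo
  have hΩs : ContDiffOn ℝ ∞ Ω (φ.target ∩ φ.symm ⁻¹' U) := by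
    rw [contDiffOn_clm_apply]
    intro v
    rw [contDiffOn_clm_apply]
    intro f
    have h1 := e.contMDiffOn_section_baseSet_iff.1
      ((P v f).contMDiff.contMDiffOn (s := e.baseSet))
    have h2 := h1.comp ((contMDiffOn_extChartAt_symm (I := 𝓘(ℝ, E)) (n := ∞) x₀).mono
      (Set.inter_subset_left (t := φ.symm ⁻¹' U))) fun z hz => (hU _ hz.2).2
    rw [contMDiffOn_iff_contDiffOn] at h2
    refine h2.congr fun z hz => ?_
    rw [hΩ, Trivialization.continuousLinearMapAt_apply_of_mem ℝ e (hU _ hz.2).2]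
    rfl
  have hSU : ∀ x ∈ φ.source, φ x ∈ φ.target ∩ φ.symm ⁻¹' U → x ∈ U := fun x hx h => by
    simpa [φ.left_inv hx] using h.2
  have hSP : ∀ x ∈ φ.source, φ x ∈ φ.target ∩ φ.symm ⁻¹' U → ∀ v f,
      S (Ω (φ x) v f) x = P v f x := by
    intro x hx h v f
    have hxU := hSU x hx h
    rw [(hU x hxU).1.1, hΩ, φ.left_inv hx]
    exact e.symmL_continuousLinearMapAt (hU x hxU).2 _
  have hSb : ∀ x ∈ U, Function.Bijective (fun f => S f x) := by
    intro x hx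
    have : (fun f => S f x) = e.symmL ℝ x := funext fun f => (hU x hx).1.1 f
    rw [this, ← e.symm_continuousLinearEquivAt_eq (hU x hx).2]
    exact ContinuousLinearEquiv.bijective _
  refine ⟨S, Ω, φ.target ∩ φ.symm ⁻¹' U, hso, ⟨mem_extChartAt_target x₀, ?_⟩,
    Set.inter_subset_left, hΩs, fun x hx hxs => ⟨hSb x (hSU x hx hxs), fun f w => ?_⟩,
    fun hcurv z hz v w => ?_⟩
  · rw [Set.mem_preimage, extChartAt_to_inv]
    exact hUx
  · rw [hSP x hx hxs, hP, D.along_apply, (hU x (hSU x hx hxs)).1.2.2.1]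
  · set x := φ.symm z with hxdef
    have hxs : x ∈ φ.source := φ.map_target hz.1
    have hφx : φ x = z := φ.right_inv hz.1
    have hd : DifferentiableAt ℝ Ω z :=
      (hΩs.contDiffAt (hso.mem_nhds hz)).differentiableAt (by simp)
    -- Leibniz rule for the section with components `Ω w f`. As the coordinate fields commute,
    -- antisymmetrizing in `v` and `w` gives the curvature.
    have key : ∀ v w f, D.along (W v) (D.along (W w) (S f)) x
        = S (fderiv ℝ Ω z v w f + Ω z v (Ω z w f)) x := by
      intro v w f
      have hcoord := mvfderiv_comp_extChartAt (h := fun z => Ω z w f) hxs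
        (by
          change DifferentiableAt ℝ _ (φ x)
          rw [hφx]
          exact (hd.clm_apply (differentiableAt_const w)).clm_apply (differentiableAt_const f))
      have hev : ∀ᶠ y in 𝓝 x, S (Ω (φ y) w f) y = D.along (W w) (S f) y := by
        have h1 : φ.source ∩ φ ⁻¹' (φ.target ∩ φ.symm ⁻¹' U) ∈ 𝓝 x :=
          ((continuousOn_extChartAt x₀).isOpen_inter_preimage
            (isOpen_extChartAt_source x₀) hso).mem_nhds ⟨hxs, by rw [Set.mem_preimage, hφx]; exact hz⟩
        filter_upwards [h1] with y hy
        exact hSP y hy.1 hy.2 w f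
      rw [D.along_apply, ← D.toFun_congr (ContMDiffSection.mdifferentiableAt _) hev]
      rw [D.toFun_linear_sections S hcoord.1, hcoord.2]
      change S (fderiv ℝ (fun z => Ω z w f) (φ x) _) x + D.along (W v) (S (Ω (φ x) w f)) x = _
      rw [(hU x hz.2).1.2.1, ← hP v, ← hSP x hxs (by rw [hφx]; exact hz), hφx]
      have hfd : fderiv ℝ (fun z => Ω z w f) z v = fderiv ℝ Ω z v w f := by
        have h1 := ((hd.hasFDerivAt.clm_apply (hasFDerivAt_const w z)).clm_apply
          (hasFDerivAt_const f z)).fderiv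
        refine (congrArg (fun T => T v) h1).trans ?_
        change Ω z w 0 + (Ω z 0 f + fderiv ℝ Ω z v w f) = _
        rw [map_zero, map_zero, zero_add, zero_apply, zero_add]
      rw [hfd]
      exact (congrArg (fun X => X x) (map_add S _ _)).symm
    ext f
    have hc := hcurv (W v) (W w) (S f) x
    rw [SmoothConnection.curvatureAt, key, key, (hU x hz.2).1.2.2.2, map_zero, sub_zero] at hc
    refine (hSb x hz.2).1 (Eq.trans ?_ (hc.trans ?_))
    · change _ = (S _ - S _) x
      rw [← map_sub]
      congr 2
      simp only [add_apply, sub_apply, mul_apply_eq_comp]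
      abel
    · simp

end ParallelFrames

/-! ### Parallel frames of a flat connection -/

section FlatFrames

variable {E : Type*} [NormedAddCommGroup E] [NormedSpace ℝ E] [FiniteDimensional ℝ E]
  {M : Type*} [TopologicalSpace M] [T2Space M] [ChartedSpace E M] [IsManifold 𝓘(ℝ, E) ∞ M]
  {F : Type*} [NormedAddCommGroup F] [NormedSpace ℝ F] [FiniteDimensional ℝ F]
  {V : M → Type*} [TopologicalSpace (TotalSpace F V)]
  [∀ x, AddCommGroup (V x)] [∀ x, Module ℝ (V x)] [∀ x, TopologicalSpace (V x)]
  [∀ x, IsTopologicalAddGroup (V x)] [∀ x, ContinuousSMul ℝ (V x)]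
  [FiberBundle F V] [VectorBundle ℝ F V] [ContMDiffVectorBundle ∞ F V 𝓘(ℝ, E)]

/-- The part of the preferred chart at `x₀` that lies over a ball about the image of `x₀`. -/
def chartBall (E : Type*) [NormedAddCommGroup E] [NormedSpace ℝ E] {M : Type*} [TopologicalSpace M]
    [ChartedSpace E M] (x₀ : M) (ρ : ℝ) : Set M :=
  (extChartAt 𝓘(ℝ, E) x₀).source ∩
    extChartAt 𝓘(ℝ, E) x₀ ⁻¹' Metric.ball (extChartAt 𝓘(ℝ, E) x₀ x₀) ρ

theorem isOpen_chartBall (x₀ : M) (ρ : ℝ) : IsOpen (chartBall E x₀ ρ) :=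
  (continuousOn_extChartAt x₀).isOpen_inter_preimage (isOpen_extChartAt_source x₀)
    Metric.isOpen_ball

theorem mem_chartBall (x₀ : M) {ρ : ℝ} (hρ : 0 < ρ) : x₀ ∈ chartBall E x₀ ρ :=
  ⟨mem_extChartAt_source x₀, Metric.mem_ball_self hρ⟩

/-- A function with vanishing differential is constant on a chart ball. -/
theorem eq_of_mvfderiv_eq_zero {G : Type*} [NormedAddCommGroup G] [NormedSpace ℝ G] {c : M → G}
    {x₀ : M} {ρ : ℝ} (hρ : 0 < ρ)
    (hb : Metric.ball (extChartAt 𝓘(ℝ, E) x₀ x₀) ρ ⊆ (extChartAt 𝓘(ℝ, E) x₀).target)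
    (hc : ∀ x ∈ chartBall E x₀ ρ, MDifferentiableAt 𝓘(ℝ, E) 𝓘(ℝ, G) c x ∧
      ∀ w, mvfderiv 𝓘(ℝ, E) c x w = 0) {x : M} (hx : x ∈ chartBall E x₀ ρ) : c x = c x₀ := by
  have : IsManifold 𝓘(ℝ, E) 1 M := .of_le (n := ∞) (by exact_mod_cast le_top)
  set φ := extChartAt 𝓘(ℝ, E) x₀
  have hd : ∀ z ∈ Metric.ball (φ x₀) ρ, HasFDerivAt (fun z => c (φ.symm z)) (0 : E →L[ℝ] G) z := by
    intro z hz
    have hφz : φ (φ.symm z) = z := φ.right_inv (hb hz)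
    have hmem : φ.symm z ∈ chartBall E x₀ ρ :=
      ⟨φ.map_target (hb hz), by change φ (φ.symm z) ∈ Metric.ball (φ x₀) ρ; rwa [hφz]⟩
    have h1 : MDifferentiableAt 𝓘(ℝ, E) 𝓘(ℝ, E) φ.symm z :=
      ((contMDiffOn_extChartAt_symm (I := 𝓘(ℝ, E)) (n := ∞) x₀).contMDiffAt
        ((isOpen_extChartAt_target x₀).mem_nhds (hb hz))).mdifferentiableAt (by simp)
    have h2 := (hc _ hmem).1.comp z h1
    have h3 : DifferentiableAt ℝ (fun z => c (φ.symm z)) z := h2.differentiableAt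
    refine h3.hasFDerivAt.congr_fderiv ?_
    ext v
    have h4 := mfderiv_comp_apply z (hc _ hmem).1 h1 v
    have h5 : fderiv ℝ (fun z => c (φ.symm z)) z v
        = mvfderiv 𝓘(ℝ, E) (fun z => c (φ.symm z)) z v := by
      rw [mvfderiv, mfderiv_eq_fderiv]
      rfl
    exact h5.trans (h4.trans ((hc _ hmem).2 _))
  have := (convex_ball (φ x₀) ρ).is_const_of_fderivWithin_eq_zero (𝕜 := ℝ)
    (f := fun z => c (φ.symm z)) (fun z hz => (hd z hz).differentiableAt.differentiableWithinAt)
    (fun z hz => by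
      rw [fderivWithin_of_isOpen Metric.isOpen_ball hz]
      exact (hd z hz).fderiv) hx.2 (Metric.mem_ball_self hρ)
  exact ((congrArg c (φ.left_inv hx.1)).symm.trans this).trans
    (congrArg c (φ.left_inv (mem_extChartAt_source x₀)))

/-- A connection without curvature has, near any point, a frame of parallel sections. -/
theorem SmoothConnection.exists_parallel_frame (D : SmoothConnection 𝓘(ℝ, E) F V)
    (hcurv : ∀ W W' Z x, D.curvatureAt W W' Z x = 0) (x₀ : M) :
    ∃ ρ > 0, Metric.ball (extChartAt 𝓘(ℝ, E) x₀ x₀) ρ ⊆ (extChartAt 𝓘(ℝ, E) x₀).target ∧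
      ∃ X : F →ₗ[ℝ] Cₛ^∞⟮𝓘(ℝ, E); F, V⟯, ∀ x ∈ chartBall E x₀ ρ,
        Function.Bijective (fun f => X f x) ∧ ∀ f w, D.toFun (X f) x w = 0 := by
  obtain ⟨S, Ω, s, hso, hs₀, hst, hΩ, hS, hflat⟩ := D.exists_connection_form x₀
  obtain ⟨r, hr, hrs, g, hg, hgu, hgd⟩ := exists_flat_gauge (hso.mem_nhds hs₀) hΩ (hflat hcurv)
  set φ := extChartAt 𝓘(ℝ, E) x₀
  obtain ⟨ψ, hψ, h1, hsupp⟩ := exists_smooth_cutoff (E := E)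
    ((isOpen_chartBall (E := E) x₀ r).mem_nhds (mem_chartBall x₀ hr))
  have hsm : ∀ f, ContMDiffOn 𝓘(ℝ, E) (𝓘(ℝ, E).prod 𝓘(ℝ, F)) ∞
      (fun y => TotalSpace.mk' F y (S (g (φ y) f) y)) (chartBall E x₀ r) := by
    intro f
    have h2 : ContMDiffOn 𝓘(ℝ, E) 𝓘(ℝ, F) ∞ (fun y => g (φ y) f) (chartBall E x₀ r) :=
      (hg.clm_apply contDiffOn_const).contMDiffOn.comp
        ((contMDiffOn_extChartAt (I := 𝓘(ℝ, E)) (n := ∞) (x := x₀)).mono fun y hy => by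
          simpa using hy.1) fun y hy => hy.2
    exact (contMDiff_linear_sections S).comp_contMDiffOn (contMDiffOn_id.prodMk h2)
  -- The gauge-transformed frame `S (g f)` has derivative `S (dg f + Ω g f) = 0`. It is cut off by
  -- `ψ` to give global sections, on which the algebroid bracket is defined.
  let X : F →ₗ[ℝ] Cₛ^∞⟮𝓘(ℝ, E); F, V⟯ :=
    { toFun := fun f => ⟨ψ • fun y => S (g (φ y) f) y,
        hψ.contMDiffOn.smul_section_of_tsupport (isOpen_chartBall x₀ r) hsupp (hsm f)⟩
      map_add' := fun f f' => by
        ext y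
        change ψ y • S (g (φ y) (f + f')) y = ψ y • S (g (φ y) f) y + ψ y • S (g (φ y) f') y
        rw [map_add, map_add, ← smul_add]
        rfl
      map_smul' := fun c f => by
        ext y
        change ψ y • S (g (φ y) (c • f)) y = c • ψ y • S (g (φ y) f) y
        rw [map_smul, map_smul, smul_comm c]
        rfl }
  have hX : ∀ f y, ψ y = 1 → X f y = S (g (φ y) f) y := fun f y hy => by
    change ψ y • S (g (φ y) f) y = _
    rw [hy, one_smul]
  -- The ball is shrunk until `ψ = 1` over it, so that the cutoff does not spoil parallelism there.
  have hn : {z | ψ (φ.symm z) = 1} ∈ 𝓝 (φ x₀) :=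
    (continuousAt_extChartAt_symm x₀).preimage_mem_nhds (by
      rw [extChartAt_to_inv (I := 𝓘(ℝ, E)) x₀]
      exact h1)
  obtain ⟨ρ₁, hρ₁, hρψ⟩ := Metric.mem_nhds_iff.1 hn
  have hψ1 : ∀ y ∈ chartBall E x₀ (min ρ₁ r), ψ y = 1 := fun y hy => by
    have h := hρψ (Metric.ball_subset_ball (min_le_left _ _) hy.2)
    change ψ (φ.symm (φ y)) = 1 at h
    rwa [φ.left_inv hy.1] at h
  refine ⟨min ρ₁ r, lt_min hρ₁ hr, ((Metric.ball_subset_ball (min_le_right _ _)).trans hrs).trans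
    hst, X, fun x hx => ?_⟩
  have hxr : φ x ∈ Metric.ball (φ x₀) r := Metric.ball_subset_ball (min_le_right _ _) hx.2
  have hSx := hS x hx.1 (hrs hxr)
  refine ⟨?_, fun f w => ?_⟩
  · have : (fun f => X f x) = (fun f => S f x) ∘ g (φ x) := funext fun f => hX f x (hψ1 x hx)
    rw [this]
    obtain ⟨u, hu⟩ := hgu _ hxr
    refine hSx.1.comp ?_
    rw [← hu]
    exact (ContinuousLinearEquiv.unitsEquiv ℝ F u).bijective
  · have hgx : DifferentiableAt ℝ g (φ x) :=
      (hg.contDiffAt (Metric.isOpen_ball.mem_nhds hxr)).differentiableAt (by simp)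
    have hcoord := mvfderiv_comp_extChartAt (h := fun z => g z f) hx.1
      (hgx.clm_apply (differentiableAt_const f))
    have hev : ∀ᶠ y in 𝓝 x, S (g (φ y) f) y = X f y :=
      mem_of_superset ((isOpen_chartBall x₀ _).mem_nhds hx) fun y hy => (hX f y (hψ1 y hy)).symm
    rw [← D.toFun_congr (X f).mdifferentiableAt hev, D.toFun_linear_sections S hcoord.1, hcoord.2,
      hSx.2]
    set v := mvfderiv 𝓘(ℝ, E) φ x w
    have hfd : fderiv ℝ (fun z => g z f) (φ x) v = -(Ω (φ x) v (g (φ x) f)) := by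
      have h2 := (hgx.hasFDerivAt.clm_apply (hasFDerivAt_const f (φ x))).fderiv
      refine (congrArg (fun T => T v) h2).trans ?_
      change g (φ x) 0 + fderiv ℝ g (φ x) v f = _
      rw [map_zero, zero_add, hgd _ hxr]
      rfl
    change S (fderiv ℝ (fun z => g z f) (φ x) v) x + S (Ω (φ x) v (g (φ x) f)) x = 0
    rw [hfd, map_neg]
    exact neg_add_cancel _

end FlatFrames

/-! ### The Lie algebra of parallel sections and the action algebroid -/

section Symmetric

variable {E : Type*} [NormedAddCommGroup E] [NormedSpace ℝ E] [FiniteDimensional ℝ E]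
  {M : Type*} [TopologicalSpace M] [T2Space M] [ChartedSpace E M] [IsManifold 𝓘(ℝ, E) ∞ M]
  {F : Type*} [NormedAddCommGroup F] [NormedSpace ℝ F] [FiniteDimensional ℝ F]
  {V : M → Type*} [TopologicalSpace (TotalSpace F V)]
  [∀ x, AddCommGroup (V x)] [∀ x, Module ℝ (V x)] [∀ x, TopologicalSpace (V x)]
  [∀ x, IsTopologicalAddGroup (V x)] [∀ x, ContinuousSMul ℝ (V x)]
  [FiberBundle F V] [VectorBundle ℝ F V] [ContMDiffVectorBundle ∞ F V 𝓘(ℝ, E)]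

theorem exists_section_apply_eq {x : M} (v : V x) : ∃ X : Cₛ^∞⟮𝓘(ℝ, E); F, V⟯, X x = v := by
  obtain ⟨S, hS⟩ := exists_sections_eventuallyEq_symm (E := E) (F := F) (V := V) x
  refine ⟨S ((trivializationAt F V x).continuousLinearMapAt ℝ x v), ?_⟩
  rw [hS.self_of_nhds]
  exact (trivializationAt F V x).symmL_continuousLinearMapAt
    (FiberBundle.mem_baseSet_trivializationAt F V x) v

/-- The coefficients of a smooth section in a smooth frame are smooth. -/
theorem exists_frame_coefficients {U : Set M} (hU : IsOpen U)
    {X : F →ₗ[ℝ] Cₛ^∞⟮𝓘(ℝ, E); F, V⟯} (hX : ∀ x ∈ U, Function.Bijective (fun f => X f x))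
    (Z : Cₛ^∞⟮𝓘(ℝ, E); F, V⟯) :
    ∃ c : M → F, ∀ x ∈ U, MDifferentiableAt 𝓘(ℝ, E) 𝓘(ℝ, F) c x ∧ X (c x) x = Z x := by
  let c : M → F := fun x => Function.invFun (fun f => X f x) (Z x)
  have hc : ∀ x ∈ U, X (c x) x = Z x := fun x hx =>
    Function.invFun_eq ((hX x hx).2 (Z x))
  refine ⟨c, fun x hx => ⟨?_, hc x hx⟩⟩
  set e := trivializationAt F V x
  have hxe : x ∈ e.baseSet := FiberBundle.mem_baseSet_trivializationAt F V x
  have hsm : ∀ Y : Cₛ^∞⟮𝓘(ℝ, E); F, V⟯, ContMDiffAt 𝓘(ℝ, E) 𝓘(ℝ, F) ∞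
      (fun y => (e ⟨y, Y y⟩).2) x := fun Y => (contMDiffAt_section x).1 (Y.contMDiff x)
  set b := Module.finBasis ℝ F
  let T : ∀ i, F →L[ℝ] F →L[ℝ] F := fun i =>
    ContinuousLinearMap.smulRightL ℝ F F (LinearMap.toContinuousLinearMap (b.coord i))
  -- `B y` is the frame read in a trivialization. The coefficients are its inverse applied to `Z`,
  -- and inversion is smooth at an isomorphism.
  let B : M → F →L[ℝ] F := fun y => ∑ i, T i (e ⟨y, X (b i) y⟩).2
  have hB : ContMDiffAt 𝓘(ℝ, E) 𝓘(ℝ, F →L[ℝ] F) ∞ B x :=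
    ContMDiffAt.sum fun i _ => ((T i).contMDiff.contMDiffAt).comp x (hsm (X (b i)))
  have hBX : ∀ y (_ : y ∈ e.baseSet) f, B y f = (e ⟨y, X f y⟩).2 := by
    intro y hy f
    have h3 : ∀ v : V y, (e ⟨y, v⟩).2 = e.linearEquivAt ℝ y hy v := fun v => rfl
    have h4 : B y f = ∑ i, b.coord i f • (e ⟨y, X (b i) y⟩).2 := by
      simp only [B, sum_apply]
      rfl
    rw [h4]
    simp only [h3]
    rw [linear_sections_apply_eq_sum b X f, map_sum]
    exact Finset.sum_congr rfl fun i _ => (map_smul _ _ _).symm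
  have hinv : ∀ y ∈ U ∩ e.baseSet, ∃ C : F ≃L[ℝ] F, (C : F →L[ℝ] F) = B y := by
    intro y hy
    have hinj : Function.Injective (B y) := by
      intro f f' h
      rw [hBX y hy.2, hBX y hy.2] at h
      exact (hX y hy.1).1 ((e.linearEquivAt ℝ y hy.2).injective h)
    exact ⟨(LinearEquiv.ofInjectiveEndo (B y).toLinearMap hinj).toContinuousLinearEquiv, by
      ext f; rfl⟩
  have hev : ∀ᶠ y in 𝓝 x, c y = ContinuousLinearMap.inverse (B y) (e ⟨y, Z y⟩).2 := by
    filter_upwards [(hU.inter e.open_baseSet).mem_nhds ⟨hx, hxe⟩] with y hy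
    obtain ⟨C, hC⟩ := hinv y hy
    have : C (c y) = (e ⟨y, Z y⟩).2 := by
      rw [← hc y hy.1, ← hBX y hy.2, ← hC]
      rfl
    rw [← hC, ContinuousLinearMap.inverse_equiv, ← this]
    exact (C.symm_apply_apply _).symm
  obtain ⟨C, hC⟩ := hinv x ⟨hx, hxe⟩
  have hi : ContMDiffAt 𝓘(ℝ, E) 𝓘(ℝ, F →L[ℝ] F) ∞
      (fun y => ContinuousLinearMap.inverse (B y)) x := by
    have h := contDiffAt_map_inverse (𝕜 := ℝ) (n := ∞) C
    rw [hC] at h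
    exact h.contMDiffAt.comp x hB
  exact ((hi.clm_apply (hsm Z)).congr_of_eventuallyEq hev).mdifferentiableAt (by simp)

variable {A : LieAlgebroid 𝓘(ℝ, E) F V} {D : SmoothConnection 𝓘(ℝ, E) F V}

/-- Writing `Z = X c`, the Leibniz rule in the parallel frame gives `∇_w Z = X (dc w)`, so `dc = 0`
and `c` is constant on the ball. -/
theorem SmoothConnection.exists_eq_of_parallel {x₀ : M} {ρ : ℝ} (hρ : 0 < ρ)
    (hb : Metric.ball (extChartAt 𝓘(ℝ, E) x₀ x₀) ρ ⊆ (extChartAt 𝓘(ℝ, E) x₀).target)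
    {X : F →ₗ[ℝ] Cₛ^∞⟮𝓘(ℝ, E); F, V⟯} (hX : ∀ x ∈ chartBall E x₀ ρ,
      Function.Bijective (fun f => X f x) ∧ ∀ f w, D.toFun (X f) x w = 0)
    {Z : Cₛ^∞⟮𝓘(ℝ, E); F, V⟯} (hZ : ∀ x ∈ chartBall E x₀ ρ, ∀ w, D.toFun Z x w = 0) :
    ∃ f, ∀ x ∈ chartBall E x₀ ρ, Z x = X f x := by
  obtain ⟨c, hc⟩ := exists_frame_coefficients (isOpen_chartBall x₀ ρ) (fun x hx => (hX x hx).1) Z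
  refine ⟨c x₀, fun x hx => ?_⟩
  rw [← (hc x hx).2, eq_of_mvfderiv_eq_zero hρ hb (fun y hy => ⟨(hc y hy).1, fun w => ?_⟩) hx]
  have hev : ∀ᶠ t in 𝓝 y, X (c t) t = Z t :=
    mem_of_superset ((isOpen_chartBall x₀ _).mem_nhds hy) fun t ht => (hc t ht).2
  have h1 := D.toFun_linear_sections X (hc y hy).1 w
  rw [D.toFun_congr Z.mdifferentiableAt hev, hZ y hy, (hX y hy).2, add_zero] at h1
  refine (hX y hy).1.1 (h1.symm.trans ?_)
  change _ = (X 0) y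
  rw [map_zero]
  rfl

/-- For a Cartan connection, the bracket of locally parallel sections is parallel. -/
theorem LieAlgebroid.IsCartanConnection.toFun_bracket_eq_zero (hD : A.IsCartanConnection D)
    {U : Set M} (hU : IsOpen U) {X Y : Cₛ^∞⟮𝓘(ℝ, E); F, V⟯}
    (hX : ∀ x ∈ U, ∀ w, D.toFun X x w = 0) (hY : ∀ x ∈ U, ∀ w, D.toFun Y x w = 0)
    {x : M} (hx : x ∈ U) (w : TangentSpace 𝓘(ℝ, E) x) : D.toFun (A.bracket X Y) x w = 0 := by
  obtain ⟨W, rfl⟩ := exists_section_apply_eq (E := E) (F := E)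
    (V := (TangentSpace 𝓘(ℝ, E) : M → Type _)) w
  have h := hD X Y W x
  rw [hX x hx, hY x hx, sub_zero, add_zero] at h
  -- The remaining terms of the Cartan identity are brackets with `∇_W X` and `∇_W Y`. These
  -- sections vanish near `x`, not only at `x`, so locality of the bracket applies.
  have hXW : ∀ᶠ y in 𝓝 x, D.along W X y = (0 : Cₛ^∞⟮𝓘(ℝ, E); F, V⟯) y :=
    mem_of_superset (hU.mem_nhds hx) fun y hy => hX y hy (W y)
  have hYW : ∀ᶠ y in 𝓝 x, D.along W Y y = (0 : Cₛ^∞⟮𝓘(ℝ, E); F, V⟯) y :=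
    mem_of_superset (hU.mem_nhds hx) fun y hy => hY y hy (W y)
  rw [A.bracket_congr hXW (Eventually.of_forall fun _ => rfl),
    A.bracket_congr (Eventually.of_forall fun _ => rfl) hYW, map_zero, map_zero] at h
  exact h.trans (add_zero (0 : V x))

/-- The parallel sections over a chart ball form a Lie algebra. -/
theorem LieAlgebroid.IsCartanConnection.exists_lieStructure (hD : A.IsCartanConnection D)
    {x₀ : M} {ρ : ℝ} (hρ : 0 < ρ)
    (hb : Metric.ball (extChartAt 𝓘(ℝ, E) x₀ x₀) ρ ⊆ (extChartAt 𝓘(ℝ, E) x₀).target)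
    {X : F →ₗ[ℝ] Cₛ^∞⟮𝓘(ℝ, E); F, V⟯} (hX : ∀ x ∈ chartBall E x₀ ρ,
      Function.Bijective (fun f => X f x) ∧ ∀ f w, D.toFun (X f) x w = 0) :
    ∃ L : LieStructure F, ∀ ξ η, ∀ x ∈ chartBall E x₀ ρ,
      A.bracket (X ξ) (X η) x = X (L.bracket ξ η) x := by
  have hx₀ : x₀ ∈ chartBall E x₀ ρ := mem_chartBall x₀ hρ
  let ev : F ≃ₗ[ℝ] V x₀ := LinearEquiv.ofBijective ((sectionEval F V x₀).comp X) (hX x₀ hx₀).1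
  -- The bracket is read off at `x₀`; being parallel, it has the same coefficients throughout the
  -- ball.
  let β : F →ₗ[ℝ] F →ₗ[ℝ] F :=
    (A.bracket.compl₁₂ X X).compr₂ (ev.symm.toLinearMap.comp (sectionEval F V x₀))
  have hβ₀ : ∀ ξ η, X (β ξ η) x₀ = A.bracket (X ξ) (X η) x₀ := fun ξ η =>
    ev.apply_symm_apply (A.bracket (X ξ) (X η) x₀)
  have hβ : ∀ ξ η, ∀ x ∈ chartBall E x₀ ρ, A.bracket (X ξ) (X η) x = X (β ξ η) x := by
    intro ξ η
    obtain ⟨f, hf⟩ := D.exists_eq_of_parallel hρ hb hX (Z := A.bracket (X ξ) (X η))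
      fun x hx w => hD.toFun_bracket_eq_zero (isOpen_chartBall x₀ ρ)
        (fun x hx => (hX x hx).2 ξ) (fun x hx => (hX x hx).2 η) hx w
    have : β ξ η = f := (hX x₀ hx₀).1.1 ((hβ₀ ξ η).trans (hf x₀ hx₀))
    rwa [this]
  -- Nested brackets involve derivatives, so the Jacobi identity needs this equality near `x₀` and
  -- not just at `x₀`.
  have hev : ∀ ξ η, ∀ᶠ x in 𝓝 x₀, X (β ξ η) x = A.bracket (X ξ) (X η) x := fun ξ η =>
    mem_of_superset ((isOpen_chartBall x₀ ρ).mem_nhds hx₀) fun x hx => (hβ ξ η x hx).symm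
  have hrefl : ∀ ξ, ∀ᶠ x in 𝓝 x₀, X ξ x = X ξ x := fun ξ => Eventually.of_forall fun _ => rfl
  refine ⟨⟨β, fun ξ => (hX x₀ hx₀).1.1 ?_, fun ξ η ζ => (hX x₀ hx₀).1.1 ?_⟩, hβ⟩
  · change X (β ξ ξ) x₀ = X 0 x₀
    rw [hβ₀, A.bracket_self, map_zero]
  · change X (β ξ (β η ζ)) x₀ = X (β (β ξ η) ζ + β η (β ξ ζ)) x₀
    rw [map_add]
    change _ = X (β (β ξ η) ζ) x₀ + X (β η (β ξ ζ)) x₀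
    rw [hβ₀, hβ₀, hβ₀, A.bracket_congr (hrefl ξ) (hev η ζ), A.bracket_congr (hev ξ η) (hrefl ζ),
      A.bracket_congr (hrefl η) (hev ξ ζ), A.jacobi]
    rfl

/-- A frame of parallel sections which is closed under the bracket identifies the algebroid with an
action algebroid. -/
theorem LieAlgebroid.isSymmetricOn_of_parallel_frame {U : Set M} (hU : IsOpen U)
    {X : F →ₗ[ℝ] Cₛ^∞⟮𝓘(ℝ, E); F, V⟯}
    (hX : ∀ x ∈ U, Function.Bijective (fun f => X f x) ∧ ∀ f w, D.toFun (X f) x w = 0)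
    (L : LieStructure F)
    (hL : ∀ ξ η, ∀ x ∈ U, A.bracket (X ξ) (X η) x = X (L.bracket ξ η) x) :
    A.IsSymmetricOn D U := by
  have hsm := contMDiff_linear_sections X
  let a : InfinitesimalAction 𝓘(ℝ, E) L U :=
    { toFun :=
        { toFun := fun ξ x => A.anchor x (X ξ x)
          map_add' := fun ξ η => by
            funext x
            rw [map_add]
            exact map_add (A.anchor x) (X ξ x) (X η x)
          map_smul' := fun r ξ => by
            funext x
            rw [map_smul]
            exact map_smul (A.anchor x) r (X ξ x) }
      smooth := (A.anchor_smooth.comp hsm).contMDiffOn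
      map_bracket := fun ξ η x hx => by
        refine Eq.trans ?_ (A.anchor_bracket (X ξ) (X η) x)
        exact congrArg (A.anchor x) (hL ξ η x hx).symm }
  have hconn : ∀ ξ : M → F, ContMDiffOn 𝓘(ℝ, E) 𝓘(ℝ, F) ∞ ξ U → ∀ x ∈ U, ∀ w,
      D.toFun (fun y => X (ξ y) y) x w = X (mvfderiv 𝓘(ℝ, E) ξ x w) x := by
    intro ξ hξ x hx w
    rw [D.toFun_linear_sections X
      ((hξ.contMDiffAt (hU.mem_nhds hx)).mdifferentiableAt (by simp)) w, (hX x hx).2, add_zero]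
  refine ⟨F, inferInstance, inferInstance, inferInstance, L, a, ⟨
    { map := fun x => LinearMap.toContinuousLinearMap ((sectionEval F V x).comp X)
      bijective := fun x hx => (hX x hx).1
      smooth := hsm.contMDiffOn
      anchor_map := fun x hx ξ => rfl
      map_bracket := fun ξ η hξ hη x hx Y Z hY hZ => ?_
      map_connection := hconn }⟩⟩
  have hY' : ∀ w, D.toFun Y x w = X (mvfderiv 𝓘(ℝ, E) ξ x w) x := fun w => by
    rw [← D.toFun_congr Y.mdifferentiableAt (hY.mono fun y hy => hy.symm)]
    exact hconn ξ hξ x hx w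
  have hZ' : ∀ w, D.toFun Z x w = X (mvfderiv 𝓘(ℝ, E) η x w) x := fun w => by
    rw [← D.toFun_congr Z.mdifferentiableAt (hZ.mono fun y hy => hy.symm)]
    exact hconn η hη x hx w
  have hYx : Y x = X (ξ x) x := hY.self_of_nhds
  have hZx : Z x = X (η x) x := hZ.self_of_nhds
  -- At `x` the torsion of `Y`, `Z` equals that of the parallel sections with the same values, which
  -- is their bracket. The `∇` terms of `Y`, `Z` supply the derivatives in the action bracket.
  have hT := A.torsion_bar_eq_of_apply_eq D hYx hZx
  rw [torsion_bar, torsion_bar] at hT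
  change D.toFun Y x (A.anchor x (Z x)) - D.toFun Z x (A.anchor x (Y x)) + A.bracket Y Z x
    = D.toFun (X (ξ x)) x (A.anchor x (X (η x) x))
      - D.toFun (X (η x)) x (A.anchor x (X (ξ x) x)) + A.bracket (X (ξ x)) (X (η x)) x at hT
  rw [hY', hZ', (hX x hx).2, (hX x hx).2, sub_zero, zero_add, hL _ _ x hx, hYx, hZx] at hT
  change _ = ((sectionEval F V x).comp X)
    (mvfderiv 𝓘(ℝ, E) η x (A.anchor x (X (ξ x) x)) - mvfderiv 𝓘(ℝ, E) ξ x (A.anchor x (X (η x) x))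
      + L.bracket (ξ x) (η x))
  rw [map_add, map_sub]
  change _ = X (mvfderiv 𝓘(ℝ, E) η x (A.anchor x (X (ξ x) x))) x
    - X (mvfderiv 𝓘(ℝ, E) ξ x (A.anchor x (X (η x) x))) x + X (L.bracket (ξ x) (η x)) x
  rw [← hT]
  abel

/-- If the curvature along the anchor of a transitive algebroid vanishes, so does the curvature. -/
theorem LieAlgebroid.IsTransitive.curvatureAt_eq_zero (hA : A.IsTransitive)
    (h : ∀ X Y Z, A.curvature D X Y Z = 0)
    (W W' : Cₛ^∞⟮𝓘(ℝ, E); E, (TangentSpace 𝓘(ℝ, E) : M → Type _)⟯)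
    (Z : Cₛ^∞⟮𝓘(ℝ, E); F, V⟯) (x : M) : D.curvatureAt W W' Z x = 0 := by
  have : IsManifold 𝓘(ℝ, E) 2 M := .of_le (n := ∞) (WithTop.coe_le_coe.2 le_top)
  obtain ⟨v, hv⟩ := hA x (W x)
  obtain ⟨v', hv'⟩ := hA x (W' x)
  obtain ⟨X, rfl⟩ := exists_section_apply_eq (E := E) (F := F) v
  obtain ⟨Y, rfl⟩ := exists_section_apply_eq (E := E) (F := F) v'
  -- Tensoriality is stated in the first slot, so the second field is replaced between two swaps.
  rw [D.curvatureAt_eq_of_apply_eq (W₁ := A.anchorSection X) W' Z hv.symm, D.curvatureAt_swap,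
    D.curvatureAt_eq_of_apply_eq (W₁ := A.anchorSection Y) _ Z hv'.symm, ← D.curvatureAt_swap,
    ← A.curvature_apply, h]
  rfl

theorem LieAlgebroid.IsCartanConnection.isLocallySymmetric (hD : A.IsCartanConnection D)
    (h : ∀ W W' Z x, D.curvatureAt W W' Z x = 0) : A.IsLocallySymmetric D := by
  intro x₀
  obtain ⟨ρ, hρ, hb, X, hX⟩ := D.exists_parallel_frame h x₀
  obtain ⟨L, hL⟩ := hD.exists_lieStructure hρ hb hX
  exact ⟨chartBall E x₀ ρ, isOpen_chartBall x₀ ρ, mem_chartBall x₀ hρ,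
    isSymmetricOn_of_parallel_frame (isOpen_chartBall x₀ ρ) hX L hL⟩

end Symmetric

theorem corollary5p4
    {E : Type*} [NormedAddCommGroup E] [NormedSpace ℝ E] [FiniteDimensional ℝ E]
    {M : Type*} [TopologicalSpace M] [T2Space M] [SigmaCompactSpace M] [ConnectedSpace M]
    [ChartedSpace E M] [IsManifold 𝓘(ℝ, E) ∞ M]
    {F : Type*} [NormedAddCommGroup F] [NormedSpace ℝ F] [FiniteDimensional ℝ F]
    {V : M → Type*} [TopologicalSpace (TotalSpace F V)]
    [∀ x, AddCommGroup (V x)] [∀ x, Module ℝ (V x)] [∀ x, TopologicalSpace (V x)]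
    [∀ x, IsTopologicalAddGroup (V x)] [∀ x, ContinuousSMul ℝ (V x)]
    [FiberBundle F V] [VectorBundle ℝ F V] [ContMDiffVectorBundle ∞ F V 𝓘(ℝ, E)]
    (A : LieAlgebroid 𝓘(ℝ, E) F V) (D : SmoothConnection 𝓘(ℝ, E) F V)
    (hD : A.IsCartanConnection D) (hA : A.IsTransitive) :
    A.IsLocallySymmetric D ↔ A.TorsionIsParallel D := by
  exact ⟨fun h => hD.torsionIsParallel_iff.2 (h.curvature_eq_zero A D), fun h =>
    hD.isLocallySymmetric (hA.curvatureAt_eq_zero (hD.torsionIsParallel_iff.1 h))⟩
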